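/- Let $n\ge 1$ and $0<\lambda\le\Lambda$. There is a constant $C$ depending only on $n,\lambda,\Lambda$ such that the following holds. Let $D\subset\mathbb R^n$ be open, let $g\in L^2(D)$, and let $\mathbf a^\epsilon=(a^\epsilon_{ij})$ be a symmetric matrix field on $D$ with $$\lambda|\xi|^2\le a^\epsilon_{ij}(x)\xi_i\xi_j\le\Lambda|\xi|^2\qquad\text{for all }\xi\in\mathbb R^n,\ x\in D,$$ and let $r>0$ be a constant such that $$|\mathbf a^\epsilon(x)-\mathbf a^\epsilon(y)|\le \frac1r\,|x-y|\qquad\text{for all }x,y\in D,$$ where $|\cdot|$ is the Euclidean (Frobenius) norm on matrices. Let $w\in H^1(D)$ be a weak solution of $-\nabla\cdot(\mathbf a^\epsilon\nabla w)=g$ in $D$, that is, $\int_D \mathbf a^\epsilon\nabla w\cdot\nabla\varphi=\int_D g\varphi$ for all $\varphi\in C_c^\infty(D)$. Then for every open set $D'\subset\subset D$ (that is, $\overline{D'}$ is compact and contained in $D$) we have $w\in H^2(D')$ and $$|w|_{H^2(D')}\le C\left(\Big(\frac1{d'}+\frac1r\Big)|w|_{H^1(D)}+\|g\|_{L^2(D)}\right),\qquad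 d'=\mathrm{dist}(D',\partial D),$$ where $|u|_{H^k(D)}^2=\sum_{|\alpha|=k}\|D^\alpha u\|_{L^2(D)}^2$ and $1/d'=0$ if $d'=\infty$ (i.e. if $D'$ or $\partial D$ is empty). -/

import Mathlib

open MeasureTheory Set
open scoped ENNReal NNReal ContDiff Matrix Matrix.Norms.Frobenius

namespace InteriorH2

/-- `ℝⁿ` with the Euclidean norm. -/
abbrev E (n : ℕ) : Type := EuclideanSpace ℝ (Fin n)

/-- The coordinate unit vector `e_i`. -/
noncomputable def e {n : ℕ} (i : Fin n) : E n := EuclideanSpace.single i 1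

/-- `φ ∈ C_c^∞(D)`. -/
structure IsTestFunction {n : ℕ} (D : Set (E n)) (φ : E n → ℝ) : Prop where
  contDiff : ContDiff ℝ ∞ φ
  hasCompactSupport : HasCompactSupport φ
  tsupport_subset : tsupport φ ⊆ D

/-- The classical derivative `∂_{m_0} ⋯ ∂_{m_{k-1}} φ`. -/
noncomputable def classicalDeriv {n k : ℕ} (m : Fin k → Fin n) (φ : E n → ℝ) (x : E n) : ℝ :=
  iteratedFDeriv ℝ k φ x (fun l => e (m l))

/-- `v` is the weak derivative `∂_{m_0} ⋯ ∂_{m_{k-1}} u` in the open set `D`: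
`∫_D u ∂_{m_0} ⋯ ∂_{m_{k-1}} φ = (-1)^k ∫_D v φ` for every `φ ∈ C_c^∞(D)`. -/
structure HasWeakDeriv {n k : ℕ} (D : Set (E n)) (m : Fin k → Fin n) (u v : E n → ℝ) : Prop where
  locallyIntegrableOn : LocallyIntegrableOn u D
  locallyIntegrableOn_deriv : LocallyIntegrableOn v D
  integral_eq : ∀ φ : E n → ℝ, IsTestFunction D φ →
    ∫ x in D, u x * classicalDeriv m φ x = (-1) ^ k * ∫ x in D, v x * φ x

open Classical in
/-- A representative of the weak derivative `∂_{m_0} ⋯ ∂_{m_{k-1}} u` in `D` (it is unique up to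
a null set of `D`), and `0` if `u` has no such weak derivative. -/
noncomputable def weakDeriv {n k : ℕ} (D : Set (E n)) (m : Fin k → Fin n) (u : E n → ℝ) :
    E n → ℝ :=
  if h : ∃ v, HasWeakDeriv D m u v then h.choose else 0

/-- `u ∈ H^k(D)`: all weak derivatives of order at most `k` (including `u` itself) exist and are
square integrable on `D`. -/
def MemSobolev {n : ℕ} (D : Set (E n)) (k : ℕ) (u : E n → ℝ) : Prop :=
  MemLp u 2 (volume.restrict D) ∧
    ∀ j ≤ k, ∀ m : Fin j → Fin n, ∃ v, MemLp v 2 (volume.restrict D) ∧ HasWeakDeriv D m u v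

open Classical in
/-- The seminorm `|u|_{H^k(D)} = (∑_{|α| = k} ‖D^α u‖²_{L²(D)})^{1/2}`. A multi-index `α` with
`|α| = k` is given by the nondecreasing `k`-tuple in which `i` occurs `α_i` times, so every `α` is
counted exactly once. -/
noncomputable def sobolevSeminorm {n : ℕ} (D : Set (E n)) (k : ℕ) (u : E n → ℝ) : ℝ≥0∞ :=
  (∑ m : Fin k → Fin n with Monotone m,
    eLpNorm (weakDeriv D m u) 2 (volume.restrict D) ^ 2) ^ (1 / 2 : ℝ)

/-- The weak gradient of `u` in `D`. -/
noncomputable def weakGrad {n : ℕ} (D : Set (E n)) (u : E n → ℝ) (x : E n) : Fin n → ℝ :=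
  fun i => weakDeriv D ![i] u x

/-- The classical gradient of `φ`. -/
noncomputable def grad {n : ℕ} (φ : E n → ℝ) (x : E n) : Fin n → ℝ :=
  fun i => fderiv ℝ φ x (e i)

/-- `a` is symmetric with `λ |ξ|² ≤ a_{ij}(x) ξ_i ξ_j ≤ Λ |ξ|²` for all `ξ ∈ ℝⁿ` and `x ∈ D`. -/
structure IsElliptic {n : ℕ} (lam Lam : ℝ) (D : Set (E n)) (a : E n → Matrix (Fin n) (Fin n) ℝ) :
    Prop where
  symm : ∀ x ∈ D, (a x).IsSymm
  lower : ∀ x ∈ D, ∀ ξ : Fin n → ℝ, lam * (ξ ⬝ᵥ ξ) ≤ ξ ⬝ᵥ (a x *ᵥ ξ)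
  upper : ∀ x ∈ D, ∀ ξ : Fin n → ℝ, ξ ⬝ᵥ (a x *ᵥ ξ) ≤ Lam * (ξ ⬝ᵥ ξ)

/-- `w ∈ H¹(D)` is a weak solution of `-∇·(a ∇w) = g` in `D`. -/
structure IsWeakSolution {n : ℕ} (D : Set (E n)) (a : E n → Matrix (Fin n) (Fin n) ℝ)
    (g w : E n → ℝ) : Prop where
  memSobolev : MemSobolev D 1 w
  integral_eq : ∀ φ : E n → ℝ, IsTestFunction D φ →
    ∫ x in D, (a x *ᵥ weakGrad D w x) ⬝ᵥ grad φ x = ∫ x in D, g x * φ x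

/-- The distance `inf {|x - y| : x ∈ s, y ∈ t}` of two sets, which is `∞` if one of them is
empty. -/
noncomputable def setDist {n : ℕ} (s t : Set (E n)) : ℝ≥0∞ :=
  ⨅ x ∈ s, ⨅ y ∈ t, edist x y

end InteriorH2

open InteriorH2

namespace InteriorH2

open scoped Convolution Topology
open Filter

/-! Formally, one differentiates the equation in direction `k` and tests with `η² ∂_k w`:
ellipticity controls `∫ η² |D²w|²`, the Lipschitz bound controls the term `(∂_k a) ∇w` by `|∇w| /
r`, and the cutoff costs `|∇η| ≲ 1/d`. Mollification, rather than difference quotients, makes this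
rigorous.

Extend the weak gradient `G` and the flux `a G` by zero outside `D` and convolve with `ρ`. Where the
mollifier does not see `∂D`, the resulting smooth fields `v` and `A` satisfy three relations: `∂_k
v_i = ∂_i v_k` (`fderiv_conv_weakDeriv_comm`), `div A = -g ⋆ ρ` (`sum_fderiv_conv_flux`), and `∂_k
A_i = a_ij ∂_k v_j` up to a commutator (`abs_fderiv_conv_flux_sub_le`). The commutator is at most
`1/r` times the convolution of `∑ |G_j|` with `|z| |Dρ(z)|`. The mass of that kernel is bounded
independently of the scale, so Young's inequality makes the error uniform in the mollifier.

For such fields, `∫ ∂_k A_i ∂_i ψ_k = ∫ ∂_i A_i ∂_k ψ_k` with `ψ_k = η² v_k` moves the derivative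
from `g` onto `ψ`, so `g ∈ L²` is enough; absorption gives `exists_energy_estimate`. The bound
survives as the mollifier shrinks because convolutions converge weakly against a fixed test
function. The distributional second derivatives are then bounded functionals for the `L²` norm, and
Riesz representation turns them into `L²` functions (`exists_memLp_of_abs_integral_fderiv_le`). All
`d < dist(D', ∂D)` are admissible, and `le_of_forall_dist_lt` passes to the distance itself. -/

/-! ### Classical derivatives of test functions -/

theorem classicalDeriv_one {n : ℕ} (m : Fin 1 → Fin n) (φ : E n → ℝ) (x : E n) :
    classicalDeriv m φ x = fderiv ℝ φ x (e (m 0)) := by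
  simp [classicalDeriv, iteratedFDeriv_one_apply]

theorem classicalDeriv_two {n : ℕ} (m : Fin 2 → Fin n) {φ : E n → ℝ} (hφ : ContDiff ℝ ∞ φ)
    (x : E n) :
    classicalDeriv m φ x = fderiv ℝ (fun y => fderiv ℝ φ y (e (m 1))) x (e (m 0)) := by
  have h : DifferentiableAt ℝ (fderiv ℝ φ) x :=
    ((hφ.fderiv_right (m := ∞) (by simp)).differentiable (by simp)) x
  rw [classicalDeriv, iteratedFDeriv_two_apply, fderiv_clm_apply h (differentiableAt_const _)]
  simp

theorem contDiff_fderiv_apply {n : ℕ} {φ : E n → ℝ} (hφ : ContDiff ℝ ∞ φ) (v : E n) :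
    ContDiff ℝ ∞ (fun x => fderiv ℝ φ x v) :=
  (hφ.fderiv_right (m := ∞) (by simp)).clm_apply contDiff_const

theorem IsTestFunction.fderiv_apply {n : ℕ} {D : Set (E n)} {φ : E n → ℝ}
    (hφ : IsTestFunction D φ) (v : E n) : IsTestFunction D (fun x => fderiv ℝ φ x v) where
  contDiff := contDiff_fderiv_apply hφ.contDiff v
  hasCompactSupport := hφ.hasCompactSupport.fderiv_apply ℝ v
  tsupport_subset := (tsupport_fderiv_apply_subset ℝ v).trans hφ.tsupport_subset

theorem IsTestFunction.mono {n : ℕ} {D D' : Set (E n)} {φ : E n → ℝ}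
    (hφ : IsTestFunction D' φ) (h : D' ⊆ D) : IsTestFunction D φ :=
  ⟨hφ.contDiff, hφ.hasCompactSupport, hφ.tsupport_subset.trans h⟩

theorem fderiv_fderiv_comm {n : ℕ} {φ : E n → ℝ} (hφ : ContDiff ℝ ∞ φ) (x v w : E n) :
    fderiv ℝ (fun y => fderiv ℝ φ y v) x w = fderiv ℝ (fun y => fderiv ℝ φ y w) x v := by
  have h : DifferentiableAt ℝ (fderiv ℝ φ) x :=
    ((hφ.fderiv_right (m := ∞) (by simp)).differentiable (by simp)) x
  rw [fderiv_clm_apply h (differentiableAt_const _), fderiv_clm_apply h (differentiableAt_const _)]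
  have := (hφ.contDiffAt (x := x)).isSymmSndFDerivAt
    (by rw [minSmoothness_of_isRCLikeNormedField]; exact WithTop.coe_le_coe.mpr le_top)
  simpa using this w v

/-- Two derivatives can be exchanged between the factors of an integral. -/
theorem integral_fderiv_mul_fderiv_comm {n : ℕ} {A ψ : E n → ℝ} (hA : ContDiff ℝ ∞ A)
    (hψ : ContDiff ℝ ∞ ψ) (hc : HasCompactSupport ψ) (v w : E n) :
    ∫ x, fderiv ℝ A x v * fderiv ℝ ψ x w = ∫ x, fderiv ℝ A x w * fderiv ℝ ψ x v := by
  -- Integration by parts puts both derivatives on `A`, where the mixed second derivative is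
  -- symmetric in `v` and `w`.
  have key : ∀ v w : E n, ∫ x, fderiv ℝ A x v * fderiv ℝ ψ x w =
      -∫ x, fderiv ℝ (fun y => fderiv ℝ A y v) x w * ψ x := by
    intro v w
    have h1 := contDiff_fderiv_apply hA v
    have h2 := contDiff_fderiv_apply h1 w
    have h3 := contDiff_fderiv_apply hψ w
    refine integral_mul_fderiv_eq_neg_fderiv_mul_of_integrable ?_ ?_ ?_
      (fun x _ => (h1.differentiable (by simp)) x) (fun x _ => (hψ.differentiable (by simp)) x)
    · exact (h2.continuous.mul hψ.continuous).integrable_of_hasCompactSupport hc.mul_left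
    · exact (h1.continuous.mul h3.continuous).integrable_of_hasCompactSupport
        (hc.fderiv_apply ℝ w).mul_left
    · exact (h1.continuous.mul hψ.continuous).integrable_of_hasCompactSupport hc.mul_left
  rw [key, key]
  simp_rw [fderiv_fderiv_comm hA _ v w]

/-! ### Convolution: smoothness, Young's inequality, weak convergence -/

/-- The convolution of two real functions. -/
noncomputable def conv {n : ℕ} (f k : E n → ℝ) : E n → ℝ :=
  f ⋆[ContinuousLinearMap.mul ℝ ℝ, volume] k

theorem conv_apply {n : ℕ} (f k : E n → ℝ) (x : E n) : conv f k x = ∫ y, f y * k (x - y) := rfl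

section conv

variable {n : ℕ} {f k : E n → ℝ}

theorem integrable_mul_comp_sub (hf : LocallyIntegrable f) (hk : Continuous k)
    (hc : HasCompactSupport k) (x : E n) : Integrable (fun y => f y * k (x - y)) :=
  (hc.convolutionExists_right (ContinuousLinearMap.mul ℝ ℝ) hf hk) x

theorem continuous_conv (hf : LocallyIntegrable f) (hk : Continuous k)
    (hc : HasCompactSupport k) : Continuous (conv f k) :=
  hc.continuous_convolution_right _ hf hk

theorem contDiff_conv (hf : LocallyIntegrable f) (hk : ContDiff ℝ ∞ k)
    (hc : HasCompactSupport k) : ContDiff ℝ ∞ (conv f k) :=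
  hc.contDiff_convolution_right _ hf hk

theorem fderiv_conv (hf : LocallyIntegrable f) (hk : ContDiff ℝ ∞ k)
    (hc : HasCompactSupport k) (x v : E n) :
    fderiv ℝ (conv f k) x v = ∫ y, f y * fderiv ℝ k (x - y) v := by
  have hk1 : ContDiff ℝ 1 k := hk.of_le (by exact_mod_cast le_top)
  have := (hc.hasFDerivAt_convolution_right (ContinuousLinearMap.mul ℝ ℝ) hf hk1 x).fderiv
  rw [conv, this, convolution_precompR_apply _ hf (hc.fderiv ℝ)
    (hk1.continuous_fderiv one_ne_zero)]
  rfl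

/-- Cauchy–Schwarz for the weight `k`: the quadratic `t ↦ ∫ (f - t)² k` is nonnegative, so its
discriminant is nonpositive. -/
theorem sq_integral_mul_le {f k : E n → ℝ} (hk0 : ∀ x, 0 ≤ k x) (hk : Integrable k)
    (hfk : Integrable (fun x => f x * k x)) (hffk : Integrable (fun x => f x ^ 2 * k x)) :
    (∫ x, f x * k x) ^ 2 ≤ (∫ x, k x) * ∫ x, f x ^ 2 * k x := by
  have h : ∀ t : ℝ, 0 ≤ (∫ x, k x) * (t * t) + (-2 * ∫ x, f x * k x) * t +
      ∫ x, f x ^ 2 * k x := by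
    intro t
    have h0 : 0 ≤ ∫ x, (t * t) * k x + (-2 * t) * (f x * k x) + f x ^ 2 * k x :=
      integral_nonneg fun x => by
        have := mul_nonneg (sq_nonneg (f x - t)) (hk0 x)
        simp only [Pi.zero_apply]
        linarith
    have h1 : Integrable (fun x => t * t * k x + -2 * t * (f x * k x)) :=
      (hk.const_mul _).add (hfk.const_mul _)
    rw [integral_add h1 hffk,
      integral_add (hk.const_mul _) (hfk.const_mul _), integral_const_mul,
      integral_const_mul] at h0
    linarith
  have := discrim_le_zero h
  rw [discrim] at this
  linarith

theorem locallyIntegrable_of_memLp_two (hf : MemLp f 2) : LocallyIntegrable f :=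
  hf.locallyIntegrable (by norm_num)

/-- Young's inequality `‖f ⋆ k‖₂ ≤ ‖k‖₁ ‖f‖₂`. -/
theorem integral_conv_sq_le (hf : MemLp f 2) (hk0 : ∀ x, 0 ≤ k x) (hk : Continuous k)
    (hc : HasCompactSupport k) :
    Integrable (fun x => conv f k x ^ 2) ∧
      ∫ x, conv f k x ^ 2 ≤ (∫ x, k x) ^ 2 * ∫ x, f x ^ 2 := by
  have hfl := locallyIntegrable_of_memLp_two hf
  have hf2 : Integrable (fun x => f x ^ 2) := hf.integrable_sq
  have hki : Integrable k := hk.integrable_of_hasCompactSupport hc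
  -- Cauchy–Schwarz with weight `k (x - ·)`; integrating in `x` produces the second factor `∫ k`.
  have hpt : ∀ x, conv f k x ^ 2 ≤ (∫ x, k x) * conv (fun y => f y ^ 2) k x := by
    intro x
    rw [conv_apply, conv_apply, ← integral_sub_left_eq_self k volume x]
    exact sq_integral_mul_le (fun y => hk0 _) (hki.comp_sub_left x)
      (integrable_mul_comp_sub hfl hk hc x)
      (integrable_mul_comp_sub hf2.locallyIntegrable hk hc x)
  have hint : Integrable (conv (fun y => f y ^ 2) k) :=
    hf2.integrable_convolution (ContinuousLinearMap.mul ℝ ℝ) hki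
  have hval : ∫ x, conv (fun y => f y ^ 2) k x = (∫ x, f x ^ 2) * ∫ x, k x :=
    integral_convolution (ContinuousLinearMap.mul ℝ ℝ) hf2 hki
  have hi : Integrable (fun x => conv f k x ^ 2) := by
    refine (hint.const_mul (∫ x, k x)).mono'
      ((continuous_conv hfl hk hc).pow 2).aestronglyMeasurable (ae_of_all _ fun x => ?_)
    rw [Real.norm_of_nonneg (sq_nonneg _)]
    exact hpt x
  refine ⟨hi, (integral_mono hi (hint.const_mul _) hpt).trans_eq ?_⟩
  rw [integral_const_mul, hval]
  ring

theorem conv_comm (f k : E n → ℝ) : conv f k = conv k f := by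
  rw [conv, conv, ← convolution_flip]
  congr 1
  ext
  simp

/-- Pairing with `ψ` is convolution with the reflected `ψ` evaluated at `0`, so associativity lets
`k` act on `f ⋆ ψ(-·)`. That function is continuous even when `f` is only locally integrable. -/
theorem integral_conv_mul {ψ : E n → ℝ} (hf : LocallyIntegrable f) (hk : Continuous k)
    (hc : HasCompactSupport k) (hψ : Continuous ψ) (hψc : HasCompactSupport ψ) :
    ∫ x, conv f k x * ψ x = conv k (conv f (fun u => ψ (-u))) 0 := by
  have hψ' : Continuous (fun u => ψ (-u)) := hψ.comp continuous_neg
  have hψc' : HasCompactSupport (fun u => ψ (-u)) :=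
    hψc.comp_homeomorph (Homeomorph.neg (E n))
  have h1 : ∫ x, conv f k x * ψ x = conv (conv k f) (fun u => ψ (-u)) 0 := by
    rw [conv_comm k f, conv_apply]
    simp
  have hf' : LocallyIntegrable (fun x => ‖f x‖) := fun x => (hf x).norm
  rw [h1]
  refine convolution_assoc (ContinuousLinearMap.mul ℝ ℝ) (ContinuousLinearMap.mul ℝ ℝ)
    (ContinuousLinearMap.mul ℝ ℝ) (ContinuousLinearMap.mul ℝ ℝ)
    (fun x y z => mul_assoc x y z) hk.aestronglyMeasurable
    hf.aestronglyMeasurable hψ'.aestronglyMeasurable (ae_of_all _ fun x => ?_)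
    (ae_of_all _ fun x => ?_) ?_
  · exact hc.convolutionExists_left _ hk hf x
  · exact hψc'.norm.convolutionExists_right _ hf' hψ'.norm x
  · exact hc.norm.convolutionExists_left _ hk.norm
      (hψc'.norm.continuous_convolution_right _ hf' hψ'.norm).locallyIntegrable 0

/-- Convolutions with mollifiers converge weakly. -/
theorem exists_abs_integral_conv_mul_sub_le {ψ : E n → ℝ} (hf : LocallyIntegrable f)
    (hψ : Continuous ψ) (hψc : HasCompactSupport ψ) {δ : ℝ} (hδ : 0 < δ) :
    ∃ R > 0, ∀ k : E n → ℝ, Continuous k → HasCompactSupport k → (∀ x, 0 ≤ k x) →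
      ∫ x, k x = 1 → Function.support k ⊆ Metric.ball 0 R →
      |(∫ x, conv f k x * ψ x) - ∫ x, f x * ψ x| ≤ δ := by
  have hF : Continuous (conv f (fun u => ψ (-u))) :=
    continuous_conv hf (hψ.comp continuous_neg) (hψc.comp_homeomorph (Homeomorph.neg (E n)))
  -- `R` is the modulus of continuity at `0` of `f ⋆ ψ(-·)`; averaging over `ball 0 R` with a kernel
  -- of mass one moves the value by at most `δ`.
  obtain ⟨R, hR, h⟩ := Metric.continuous_iff.mp hF 0 δ hδ
  refine ⟨R, hR, fun k hk hc hk0 hk1 hs => ?_⟩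
  have h0 : ∫ x, f x * ψ x = conv f (fun u => ψ (-u)) 0 := by simp [conv_apply]
  rw [integral_conv_mul hf hk hc hψ hψc, h0]
  exact dist_convolution_le hδ.le hs hk0 hk1 hF.aestronglyMeasurable
    fun x hx => (h x hx).le

end conv

/-! ### Riesz representation and mollifiers -/

/-- A bounded functional on a space that maps linearly to a Hilbert space is represented by a
vector of the Hilbert space. -/
theorem exists_inner_eq_of_bounded {T H : Type*} [AddCommGroup T] [Module ℝ T]
    [NormedAddCommGroup H] [InnerProductSpace ℝ H] [CompleteSpace H] (ι : T →ₗ[ℝ] H)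
    (l : T →ₗ[ℝ] ℝ) {C : ℝ} (hC : 0 ≤ C) (h : ∀ t, |l t| ≤ C * ‖ι t‖) :
    ∃ z : H, ‖z‖ ≤ C ∧ ∀ t, l t = inner ℝ z (ι t) := by
  -- The bound forces `l` to vanish on the kernel of `ι`, so `l` descends to the range through a
  -- linear section `s`. The range need not be closed; Hahn–Banach extends the functional to `H`
  -- with the same norm before Riesz applies.
  have hker : LinearMap.ker ι.rangeRestrict ≤ LinearMap.ker l := by
    intro t ht
    rw [LinearMap.ker_rangeRestrict, LinearMap.mem_ker] at ht
    have := h t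
    rw [ht, norm_zero, mul_zero] at this
    exact abs_nonpos_iff.mp this
  obtain ⟨s, hs⟩ := ι.rangeRestrict.exists_rightInverse_of_surjective ι.range_rangeRestrict
  have hs' : ∀ y, ι.rangeRestrict (s y) = y := fun y => LinearMap.congr_fun hs y
  have hl : ∀ t, l (s (ι.rangeRestrict t)) = l t := by
    intro t
    have : s (ι.rangeRestrict t) - t ∈ LinearMap.ker ι.rangeRestrict := by
      rw [LinearMap.mem_ker, map_sub, hs', sub_self]
    have := hker this
    rwa [LinearMap.mem_ker, map_sub, sub_eq_zero] at this
  let f : StrongDual ℝ (LinearMap.range ι) := (l ∘ₗ s).mkContinuous C (by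
    intro y
    have h1 := h (s y)
    have h2 : ι (s y) = y := congrArg Subtype.val (hs' y)
    rw [h2] at h1
    exact h1)
  obtain ⟨F, hF, hFn⟩ := exists_extension_norm_eq _ f
  refine ⟨(InnerProductSpace.toDual ℝ H).symm F, ?_, fun t => ?_⟩
  · rw [LinearIsometryEquiv.norm_map, hFn]
    exact LinearMap.mkContinuous_norm_le _ hC _
  · rw [InnerProductSpace.toDual_symm_apply]
    have := hF (ι.rangeRestrict t)
    rw [LinearMap.codRestrict_apply] at this
    rw [this]
    exact (hl t).symm

/-- Mollifiers with a scale-invariant bound on `∫ |z| |Dρ(z)| dz`. -/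
theorem exists_mollifier (n : ℕ) : ∃ c : ℝ, 0 ≤ c ∧ ∀ ε > 0, ∃ ρ : E n → ℝ,
    ContDiff ℝ ∞ ρ ∧ HasCompactSupport ρ ∧ (∀ x, 0 ≤ ρ x) ∧ ∫ x, ρ x = 1 ∧
      Function.support ρ ⊆ Metric.ball 0 ε ∧ ∫ z, ‖z‖ * ‖fderiv ℝ ρ z‖ ≤ c := by
  let b : ContDiffBump (0 : E n) := ⟨1 / 2, 1, by norm_num, by norm_num⟩
  let ρ₀ : E n → ℝ := b.normed volume
  have hs₀ : ContDiff ℝ ∞ ρ₀ := b.contDiff_normed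
  refine ⟨∫ z, ‖z‖ * ‖fderiv ℝ ρ₀ z‖, integral_nonneg fun z => by positivity, fun ε hε => ?_⟩
  have hfr : Module.finrank ℝ (E n) = n := by simp
  refine ⟨fun x => (ε ^ n)⁻¹ * ρ₀ (ε⁻¹ • x), ?_, ?_, ?_, ?_, ?_, le_of_eq ?_⟩
  · exact contDiff_const.mul (hs₀.comp (contDiff_const_smul _))
  · exact (b.hasCompactSupport_normed.comp_homeomorph
      (Homeomorph.smulOfNeZero ε⁻¹ (inv_ne_zero hε.ne'))).mul_left
  · exact fun x => mul_nonneg (by positivity) (b.nonneg_normed _)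
  · rw [integral_const_mul, Measure.integral_comp_inv_smul volume ρ₀ ε, hfr,
      abs_of_pos (by positivity), smul_eq_mul, b.integral_normed, mul_one]
    exact inv_mul_cancel₀ (by positivity)
  · intro x hx
    have h1 : ε⁻¹ • x ∈ Function.support ρ₀ := fun h => hx (by simp [h])
    rw [b.support_normed_eq, mem_ball_zero_iff, norm_smul, norm_inv, Real.norm_of_nonneg hε.le,
      inv_mul_lt_iff₀ hε, mul_one] at h1
    exact mem_ball_zero_iff.mpr h1
  -- The factor `ε⁻¹` from the chain rule is absorbed by `‖z‖`, which leaves the scaling that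
  -- preserves the `L¹` norm.
  · have h1 : ∀ z, ‖z‖ * ‖fderiv ℝ (fun x => (ε ^ n)⁻¹ * ρ₀ (ε⁻¹ • x)) z‖ =
        (ε ^ n)⁻¹ * (‖ε⁻¹ • z‖ * ‖fderiv ℝ ρ₀ (ε⁻¹ • z)‖) := by
      intro z
      have hd : DifferentiableAt ℝ (fun x => ρ₀ (ε⁻¹ • x)) z :=
        ((hs₀.comp (contDiff_const_smul _)).differentiable (by simp)) z
      rw [fderiv_const_mul hd, fderiv_comp_smul, norm_smul, norm_smul, norm_smul, norm_inv,
        norm_inv, Real.norm_of_nonneg hε.le, Real.norm_of_nonneg (by positivity)]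
      ring
    simp_rw [h1]
    rw [integral_const_mul, Measure.integral_comp_inv_smul volume
      (fun z => ‖z‖ * ‖fderiv ℝ ρ₀ z‖) ε, hfr, abs_of_pos (by positivity), smul_eq_mul,
      inv_mul_cancel_left₀ (by positivity)]

/-! ### The energy estimate for smooth fields -/

theorem abs_sum_fin_le {n : ℕ} {f : Fin n → ℝ} {b : ℝ} (h : ∀ i, |f i| ≤ b) :
    |∑ i, f i| ≤ n * b := by
  refine (Finset.abs_sum_le_sum_abs _ _).trans ((Finset.sum_le_card_nsmul _ _ b
    fun i _ => h i).trans_eq ?_)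
  simp

/-- The algebraic core of the energy estimate. -/
theorem exists_energy_pointwise (n : ℕ) (lam Lam : ℝ) (hlam : 0 < lam) :
    ∃ C : ℝ, 0 ≤ C ∧ ∀ (a : Matrix (Fin n) (Fin n) ℝ) (P K : Fin n → Fin n → ℝ)
      (ζ v : Fin n → ℝ) (h η M V κ : ℝ),
      (∀ ξ : Fin n → ℝ, lam * (ξ ⬝ᵥ ξ) ≤ ξ ⬝ᵥ (a *ᵥ ξ)) → (∀ i j, |a i j| ≤ Lam) →
      (∀ i j, P i j = P j i) → 0 ≤ η → η ≤ 1 → (∀ i, |ζ i| ≤ M) → (∀ i, |v i| ≤ V) →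
      (∀ i j, |K i j| ≤ κ) → 0 ≤ M → 0 ≤ V → 0 ≤ κ → 0 ≤ Lam →
      lam / 2 * (η ^ 2 * ∑ k, ∑ i, P k i ^ 2) ≤
        ∑ k, ∑ i, (∑ j, a i j * P k j + K k i) * (η ^ 2 * P i k + 2 * η * ζ i * v k) +
          h * ∑ k, (η ^ 2 * P k k + 2 * η * ζ k * v k) +
          C * (κ ^ 2 + M ^ 2 * V ^ 2 + h ^ 2) := by
  -- The first three summands come from absorbing the terms `e1`, `e2`, `e4`, which are linear in
  -- `q`. The last two come from `e3` and `e5`, which do not contain `q`.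
  refine ⟨3 * (n : ℝ) ^ 4 / (2 * lam) + 3 * (2 * n ^ 3 * Lam) ^ 2 / (2 * lam) +
    3 * (n : ℝ) ^ 2 / (2 * lam) + 2 * n ^ 2 + 2 * n, by positivity, ?_⟩
  intro a P K ζ v h η M V κ hell ha hP hη0 hη1 hζ hv hK hM hV hκ hLam
  set q := Real.sqrt (η ^ 2 * ∑ k, ∑ i, P k i ^ 2) with hq
  have hq0 : 0 ≤ q := Real.sqrt_nonneg _
  have hqq : q ^ 2 = η ^ 2 * ∑ k, ∑ i, P k i ^ 2 :=
    Real.sq_sqrt (mul_nonneg (sq_nonneg _)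
      (Finset.sum_nonneg fun _ _ => Finset.sum_nonneg fun _ _ => sq_nonneg _))
  have hPq : ∀ k i, |η * P k i| ≤ q := by
    intro k i
    refine abs_le_of_sq_le_sq ?_ hq0
    rw [hqq, mul_pow]
    refine mul_le_mul_of_nonneg_left ?_ (sq_nonneg η)
    calc P k i ^ 2 ≤ ∑ i, P k i ^ 2 :=
          Finset.single_le_sum (f := fun i => P k i ^ 2) (fun _ _ => sq_nonneg _)
            (Finset.mem_univ i)
      _ ≤ _ := Finset.single_le_sum (f := fun k => ∑ i, P k i ^ 2)
          (fun _ _ => Finset.sum_nonneg fun _ _ => sq_nonneg _) (Finset.mem_univ k)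
  -- Symmetry of `P` replaces `P i k` by `P k i`, after which ellipticity applies to each row `P k`.
  have e0 : lam * q ^ 2 ≤ ∑ k, ∑ i, (∑ j, a i j * P k j) * (η ^ 2 * P i k) := by
    rw [hqq, ← mul_assoc, mul_comm lam, mul_assoc, Finset.mul_sum, Finset.mul_sum]
    refine Finset.sum_le_sum fun k _ => ?_
    have := mul_le_mul_of_nonneg_left (hell (P k)) (sq_nonneg η)
    simp only [dotProduct, Matrix.mulVec] at this
    calc _ = η ^ 2 * (lam * ∑ i, P k i * P k i) := by simp_rw [sq]
      _ ≤ _ := this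
      _ = _ := by
        rw [Finset.mul_sum]
        refine Finset.sum_congr rfl fun i _ => ?_
        rw [hP i k]
        ring
  have e1 : |∑ k, ∑ i, K k i * (η ^ 2 * P i k)| ≤ n * (n * (κ * q)) := by
    refine abs_sum_fin_le fun k => abs_sum_fin_le fun i => ?_
    calc |K k i * (η ^ 2 * P i k)| = |K k i| * (η * |η * P i k|) := by
          rw [abs_mul, show η ^ 2 * P i k = η * (η * P i k) by ring, abs_mul η, abs_of_nonneg hη0]
      _ ≤ κ * (1 * q) := by gcongr; exacts [hK k i, hPq i k]
      _ = κ * q := by ring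
  have e2 : |∑ k, ∑ i, (∑ j, a i j * P k j) * (2 * η * ζ i * v k)| ≤
      n * (n * (n * (Lam * q * (2 * M * V)))) := by
    refine abs_sum_fin_le fun k => abs_sum_fin_le fun i => ?_
    rw [Finset.sum_mul]
    refine abs_sum_fin_le fun j => ?_
    calc |a i j * P k j * (2 * η * ζ i * v k)| = |a i j| * |η * P k j| * (2 * |ζ i| * |v k|) := by
          rw [show a i j * P k j * (2 * η * ζ i * v k) =
            a i j * (η * P k j) * (2 * ζ i * v k) by ring, abs_mul, abs_mul (a i j),
            abs_mul (2 * ζ i), abs_mul 2, abs_two]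
      _ ≤ _ := by gcongr; exacts [ha i j, hPq k j, hζ i, hv k]
  have e3 : |∑ k, ∑ i, K k i * (2 * η * ζ i * v k)| ≤ n * (n * (κ * (2 * 1 * M * V))) := by
    refine abs_sum_fin_le fun k => abs_sum_fin_le fun i => ?_
    rw [abs_mul, abs_mul, abs_mul, abs_mul, abs_two, abs_of_nonneg hη0]
    gcongr
    exacts [hK k i, hζ i, hv k]
  have e4 : |h * ∑ k, η ^ 2 * P k k| ≤ |h| * (n * q) := by
    rw [abs_mul]
    gcongr
    refine abs_sum_fin_le fun k => ?_
    calc |η ^ 2 * P k k| = η * |η * P k k| := by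
          rw [show η ^ 2 * P k k = η * (η * P k k) by ring, abs_mul η, abs_of_nonneg hη0]
      _ ≤ 1 * q := by gcongr; exact hPq k k
      _ = q := one_mul q
  have e5 : |h * ∑ k, 2 * η * ζ k * v k| ≤ |h| * (n * (2 * 1 * M * V)) := by
    rw [abs_mul]
    gcongr
    refine abs_sum_fin_le fun k => ?_
    rw [abs_mul, abs_mul, abs_mul, abs_two, abs_of_nonneg hη0]
    gcongr
    exacts [hζ k, hv k]
  have hsplit : ∑ k, ∑ i, (∑ j, a i j * P k j + K k i) * (η ^ 2 * P i k + 2 * η * ζ i * v k) +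
      h * ∑ k, (η ^ 2 * P k k + 2 * η * ζ k * v k) =
      ∑ k, ∑ i, (∑ j, a i j * P k j) * (η ^ 2 * P i k) + ∑ k, ∑ i, K k i * (η ^ 2 * P i k) +
      ∑ k, ∑ i, (∑ j, a i j * P k j) * (2 * η * ζ i * v k) +
      ∑ k, ∑ i, K k i * (2 * η * ζ i * v k) + h * ∑ k, η ^ 2 * P k k +
      h * ∑ k, 2 * η * ζ k * v k := by
    simp only [add_mul, mul_add, Finset.sum_add_distrib]
    ring
  -- Used three times, so the absorbed amount is `lam / 2 * q ^ 2`, half of what ellipticity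
  -- provides.
  have young : ∀ α x : ℝ, α * x * q ≤ lam / 6 * q ^ 2 + 3 * α ^ 2 / (2 * lam) * x ^ 2 := by
    intro α x
    have : lam / 6 * q ^ 2 + 3 * α ^ 2 / (2 * lam) * x ^ 2 - α * x * q =
        (lam * q - 3 * (α * x)) ^ 2 / (6 * lam) := by
      field_simp
      ring
    have h2 : 0 ≤ (lam * q - 3 * (α * x)) ^ 2 / (6 * lam) := by positivity
    linarith
  have y1 := young ((n : ℝ) ^ 2) κ
  have y2 := young (2 * (n : ℝ) ^ 3 * Lam) (M * V)
  have y3 := young n |h|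
  have y4 : 2 * (κ * (M * V)) ≤ κ ^ 2 + (M * V) ^ 2 := by nlinarith [sq_nonneg (κ - M * V)]
  have y5 : 2 * (|h| * (M * V)) ≤ |h| ^ 2 + (M * V) ^ 2 := by nlinarith [sq_nonneg (|h| - M * V)]
  have y4' := mul_le_mul_of_nonneg_left y4 (sq_nonneg (n : ℝ))
  have y5' := mul_le_mul_of_nonneg_left y5 (Nat.cast_nonneg (α := ℝ) n)
  rw [hsplit, ← hqq]
  have f1 := (abs_le.mp e1).1
  have f2 := (abs_le.mp e2).1
  have f3 := (abs_le.mp e3).1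
  have f4 := (abs_le.mp e4).1
  have f5 := (abs_le.mp e5).1
  rw [sq_abs] at y3 y5'
  have hC : ∀ c1 c2 c3 c4 c5 : ℝ, 0 ≤ c1 → 0 ≤ c2 → 0 ≤ c3 → 0 ≤ c4 → 0 ≤ c5 →
      c1 * κ ^ 2 + c2 * (M * V) ^ 2 + c3 * h ^ 2 + c4 * (κ ^ 2 + (M * V) ^ 2) +
        c5 * (h ^ 2 + (M * V) ^ 2) ≤
        (c1 + c2 + c3 + 2 * c4 + 2 * c5) * (κ ^ 2 + M ^ 2 * V ^ 2 + h ^ 2) := by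
    intro c1 c2 c3 c4 c5 h1 h2 h3 h4 h5
    rw [← mul_pow]
    have : 0 ≤ c1 * ((M * V) ^ 2 + h ^ 2) + c2 * (κ ^ 2 + h ^ 2) + c3 * (κ ^ 2 + (M * V) ^ 2) +
        c4 * (κ ^ 2 + (M * V) ^ 2 + 2 * h ^ 2) + c5 * (2 * κ ^ 2 + (M * V) ^ 2 + h ^ 2) := by
      positivity
    linarith
  have hC' := hC (3 * ((n : ℝ) ^ 2) ^ 2 / (2 * lam)) (3 * (2 * n ^ 3 * Lam) ^ 2 / (2 * lam))
    (3 * (n : ℝ) ^ 2 / (2 * lam)) ((n : ℝ) ^ 2) n (by positivity) (by positivity) (by positivity)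
    (by positivity) (by positivity)
  have : ((n : ℝ) ^ 2) ^ 2 = (n : ℝ) ^ 4 := by ring
  rw [this] at hC' y1
  linarith

/-- The energy estimate for a smooth system `Aₖᵢ = aᵢⱼ ∂ₖvⱼ + O(κ)`, `-div A = h`. -/
theorem exists_energy_estimate (n : ℕ) (lam Lam : ℝ) (hlam : 0 < lam) (hLam : 0 ≤ Lam) :
    ∃ C : ℝ, 0 ≤ C ∧ ∀ (a : E n → Matrix (Fin n) (Fin n) ℝ) (v A : Fin n → E n → ℝ)
      (η h V κ : E n → ℝ) (M : ℝ), 0 ≤ M →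
      ContDiff ℝ ∞ η → HasCompactSupport η → (∀ x, 0 ≤ η x) → (∀ x, η x ≤ 1) →
      (∀ x i, |fderiv ℝ η x (e i)| ≤ M) →
      (∀ k, ContDiff ℝ ∞ (v k)) → (∀ i, ContDiff ℝ ∞ (A i)) → Continuous h →
      Integrable (fun x => h x ^ 2) → Integrable (fun x => V x ^ 2) →
      Integrable (fun x => κ x ^ 2) → (∀ x, 0 ≤ V x) → (∀ x, 0 ≤ κ x) →
      (∀ x ∈ tsupport η, (∀ ξ : Fin n → ℝ, lam * (ξ ⬝ᵥ ξ) ≤ ξ ⬝ᵥ (a x *ᵥ ξ)) ∧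
        (∀ i j, |a x i j| ≤ Lam) ∧
        (∀ k i, fderiv ℝ (v i) x (e k) = fderiv ℝ (v k) x (e i)) ∧
        ∑ i, fderiv ℝ (A i) x (e i) = -h x ∧ (∀ i, |v i x| ≤ V x) ∧
        ∀ k i, |fderiv ℝ (A i) x (e k) - ∑ j, a x i j * fderiv ℝ (v j) x (e k)| ≤ κ x) →
      ∫ x, η x ^ 2 * ∑ k, ∑ i, fderiv ℝ (v i) x (e k) ^ 2 ≤
        C * ((∫ x, κ x ^ 2) + M ^ 2 * (∫ x, V x ^ 2) + ∫ x, h x ^ 2) := by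
  obtain ⟨C, hC, hpt⟩ := exists_energy_pointwise n lam Lam hlam
  refine ⟨2 / lam * C, by positivity, ?_⟩
  intro a v A η h V κ M hM hη hηc hη0 hη1 hηM hv hA hh hhi hVi hκi hV hκ hx
  have hψ : ∀ k, ContDiff ℝ ∞ (fun x => η x ^ 2 * v k x) := fun k => (hη.pow 2).mul (hv k)
  have hψs : ∀ k, tsupport (fun x => η x ^ 2 * v k x) ⊆ tsupport η := fun k =>
    closure_mono fun x hx hx' => hx (by simp [hx'])
  have hψc : ∀ k, HasCompactSupport (fun x => η x ^ 2 * v k x) := fun k =>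
    hηc.of_isClosed_subset (isClosed_tsupport _) (hψs k)
  have hψ' : ∀ k x i, fderiv ℝ (fun x => η x ^ 2 * v k x) x (e i) =
      η x ^ 2 * fderiv ℝ (v k) x (e i) + 2 * η x * fderiv ℝ η x (e i) * v k x := by
    intro k x i
    have d1 : DifferentiableAt ℝ η x := (hη.differentiable (by simp)) x
    have d2 : DifferentiableAt ℝ (v k) x := ((hv k).differentiable (by simp)) x
    have h1 := (d1.hasFDerivAt.pow 2).mul d2.hasFDerivAt
    have h2 : fderiv ℝ (fun x => η x ^ 2 * v k x) x = _ := h1.fderiv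
    rw [h2]
    simp
    ring
  have hψ0 : ∀ k x i, x ∉ tsupport η → fderiv ℝ (fun x => η x ^ 2 * v k x) x (e i) = 0 := by
    intro k x i hx
    have h0 : x ∉ tsupport (fderiv ℝ (fun x => η x ^ 2 * v k x)) := fun h' =>
      hx (hψs k (tsupport_fderiv_subset ℝ h'))
    rw [image_eq_zero_of_notMem_tsupport h0]
    rfl
  have i1 : ∀ (f : E n → ℝ) k i, Continuous f →
      Integrable (fun x => f x * fderiv ℝ (fun x => η x ^ 2 * v k x) x (e i)) := by
    intro f k i hf
    exact (hf.mul (contDiff_fderiv_apply (hψ k) (e i)).continuous).integrable_of_hasCompactSupport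
      ((hψc k).fderiv_apply ℝ (e i)).mul_left
  have cA : ∀ k i, Continuous (fun x => fderiv ℝ (A i) x (e k)) := fun k i =>
    (contDiff_fderiv_apply (hA i) (e k)).continuous
  have cv : ∀ k i, Continuous (fun x => fderiv ℝ (v i) x (e k)) := fun k i =>
    (contDiff_fderiv_apply (hv i) (e k)).continuous
  have S1 : Integrable (fun x => ∑ k, ∑ i, fderiv ℝ (A i) x (e k) *
      fderiv ℝ (fun x => η x ^ 2 * v k x) x (e i)) :=
    integrable_finsetSum _ fun k _ => integrable_finsetSum _ fun i _ => i1 _ k i (cA k i)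
  have S2 : Integrable (fun x => ∑ k, h x * fderiv ℝ (fun x => η x ^ 2 * v k x) x (e k)) :=
    integrable_finsetSum _ fun k _ => i1 _ k k hh
  -- Exchanging `∂_k` and `∂_i` between the factors produces `div A = -h`, so `h` is never
  -- differentiated. The divergence equation holds only on `tsupport η`, but the derivatives of `η²
  -- v_k` vanish elsewhere.
  have hS : (∫ x, ∑ k, ∑ i, fderiv ℝ (A i) x (e k) *
        fderiv ℝ (fun x => η x ^ 2 * v k x) x (e i)) +
      ∫ x, ∑ k, h x * fderiv ℝ (fun x => η x ^ 2 * v k x) x (e k) = 0 := by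
    rw [integral_finsetSum _ fun k _ => integrable_finsetSum _ fun i _ => i1 _ k i (cA k i),
      integral_finsetSum _ fun k _ => i1 _ k k hh, ← Finset.sum_add_distrib]
    refine Finset.sum_eq_zero fun k _ => ?_
    rw [integral_finsetSum _ fun i _ => i1 _ k i (cA k i)]
    simp_rw [integral_fderiv_mul_fderiv_comm (hA _) (hψ k) (hψc k) (e k) (e _)]
    rw [← integral_finsetSum _ fun i _ => i1 _ k k (cA i i), ← integral_add
      (integrable_finsetSum _ fun i _ => i1 _ k k (cA i i)) (i1 _ k k hh)]
    refine integral_eq_zero_of_ae (ae_of_all _ fun x => ?_)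
    by_cases hxs : x ∈ tsupport η
    · simp only [← Finset.sum_mul, (hx x hxs).2.2.2.1, Pi.zero_apply]
      ring
    · simp [hψ0 k x k hxs]
  have key : ∀ x, lam / 2 * (η x ^ 2 * ∑ k, ∑ i, fderiv ℝ (v i) x (e k) ^ 2) ≤
      (∑ k, ∑ i, fderiv ℝ (A i) x (e k) * fderiv ℝ (fun x => η x ^ 2 * v k x) x (e i)) +
      (∑ k, h x * fderiv ℝ (fun x => η x ^ 2 * v k x) x (e k)) +
      C * (κ x ^ 2 + M ^ 2 * V x ^ 2 + h x ^ 2) := by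
    intro x
    by_cases hxs : x ∈ tsupport η
    · obtain ⟨h1, h2, h3, -, h5, h6⟩ := hx x hxs
      have := hpt (a x) (fun k i => fderiv ℝ (v i) x (e k))
        (fun k i => fderiv ℝ (A i) x (e k) - ∑ j, a x i j * fderiv ℝ (v j) x (e k))
        (fun i => fderiv ℝ η x (e i)) (fun k => v k x) (h x) (η x) M (V x) (κ x)
        h1 h2 h3 (hη0 x) (hη1 x) (hηM x) h5 h6 hM (hV x) (hκ x) hLam
      simp only [add_sub_cancel, ← hψ'] at this
      rwa [Finset.mul_sum _ _ (h x)] at this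
    · have h0 : η x = 0 := image_eq_zero_of_notMem_tsupport hxs
      simp only [hψ0 _ x _ hxs, h0]
      simp only [mul_zero, Finset.sum_const_zero, zero_add, ne_eq, OfNat.ofNat_ne_zero,
        not_false_eq_true, zero_pow, zero_mul]
      positivity
  have hP : Integrable (fun x => η x ^ 2 * ∑ k, ∑ i, fderiv ℝ (v i) x (e k) ^ 2) := by
    refine Continuous.integrable_of_hasCompactSupport ?_ ?_
    · exact (hη.continuous.pow 2).mul (continuous_finsetSum _ fun k _ =>
        continuous_finsetSum _ fun i _ => (cv k i).pow 2)
    · exact HasCompactSupport.mul_right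
        (hηc.of_isClosed_subset (isClosed_tsupport _)
          (closure_mono fun x hx hx' => hx (by simp [hx'])))
  have I := integral_mono (hP.const_mul (lam / 2)) ((S1.add S2).add
    (((hκi.add (hVi.const_mul (M ^ 2))).add hhi).const_mul C)) key
  have J : ∫ x, ((((fun x => ∑ k, ∑ i, fderiv ℝ (A i) x (e k) *
      fderiv ℝ (fun x => η x ^ 2 * v k x) x (e i)) +
      fun x => ∑ k, h x * fderiv ℝ (fun x => η x ^ 2 * v k x) x (e k)) +
      fun x => C * ((((fun x => κ x ^ 2) + fun x => M ^ 2 * V x ^ 2) +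
        fun x => h x ^ 2) x)) x) =
      C * ((∫ x, κ x ^ 2) + M ^ 2 * (∫ x, V x ^ 2) + ∫ x, h x ^ 2) := by
    rw [integral_add' (S1.add S2)
      (((hκi.add (hVi.const_mul (M ^ 2))).add hhi).const_mul C), integral_add' S1 S2, hS,
      integral_const_mul, integral_add' (hκi.add (hVi.const_mul (M ^ 2))) hhi,
      integral_add' hκi (hVi.const_mul (M ^ 2)), integral_const_mul, zero_add]
  rw [integral_const_mul] at I
  have I' := I.trans_eq J
  calc _ = 2 / lam * (lam / 2 *
        ∫ x, η x ^ 2 * ∑ k, ∑ i, fderiv ℝ (v i) x (e k) ^ 2) := by field_simp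
    _ ≤ 2 / lam * (C * ((∫ x, κ x ^ 2) + M ^ 2 * (∫ x, V x ^ 2) + ∫ x, h x ^ 2)) := by gcongr
    _ = _ := by ring

/-! ### The mollified equation -/

theorem abs_entry_le_frobenius_norm {n : ℕ} (A : Matrix (Fin n) (Fin n) ℝ) (i j : Fin n) :
    |A i j| ≤ ‖A‖ := by
  rw [Matrix.frobenius_norm_def, ← Real.sqrt_eq_rpow]
  refine Real.abs_le_sqrt ?_
  simp only [Real.rpow_two, Real.norm_eq_abs, sq_abs]
  calc A i j ^ 2 ≤ ∑ j, A i j ^ 2 :=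
        Finset.single_le_sum (f := fun j => A i j ^ 2) (fun _ _ => sq_nonneg _) (Finset.mem_univ j)
    _ ≤ _ := Finset.single_le_sum (f := fun i => ∑ j, A i j ^ 2)
        (fun _ _ => Finset.sum_nonneg fun _ _ => sq_nonneg _) (Finset.mem_univ i)

/-- Nonnegativity of the form at `e_i ± e_j` gives `2 |a_ij| ≤ a_ii + a_jj`, and the upper bound at
`e_i` and `e_j` gives `a_ii, a_jj ≤ Λ`. -/
theorem IsElliptic.abs_entry_le {n : ℕ} {lam Lam : ℝ} {D : Set (E n)}
    {a : E n → Matrix (Fin n) (Fin n) ℝ} (ha : IsElliptic lam Lam D a) (hlam : 0 < lam)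
    {x : E n} (hx : x ∈ D) (i j : Fin n) : |a x i j| ≤ Lam := by
  have hs : a x j i = a x i j := (ha.symm x hx).apply i j
  have key : ∀ s t : ℝ, ((s • Pi.single i 1 + t • Pi.single j 1 : Fin n → ℝ) ⬝ᵥ
      (a x *ᵥ (s • Pi.single i 1 + t • Pi.single j 1))) =
      s ^ 2 * a x i i + 2 * s * t * a x i j + t ^ 2 * a x j j := by
    intro s t
    simp only [Matrix.mulVec_add, Matrix.mulVec_smul, Matrix.mulVec_single_one, add_dotProduct,
      dotProduct_add, smul_dotProduct, dotProduct_smul, single_dotProduct, Matrix.col_apply,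
      smul_eq_mul, one_mul, hs]
    ring
  have hii : a x i i ≤ Lam := by
    have h1 := ha.upper x hx (Pi.single i 1)
    simpa using h1
  have hjj : a x j j ≤ Lam := by
    have h1 := ha.upper x hx (Pi.single j 1)
    simpa using h1
  have hnn : ∀ ξ : Fin n → ℝ, 0 ≤ ξ ⬝ᵥ (a x *ᵥ ξ) := fun ξ =>
    (mul_nonneg hlam.le (by simpa using dotProduct_self_star_nonneg ξ)).trans (ha.lower x hx ξ)
  have h1 := hnn ((1 : ℝ) • Pi.single i 1 + (1 : ℝ) • Pi.single j 1)
  have h2 := hnn ((1 : ℝ) • Pi.single i 1 + (-1 : ℝ) • Pi.single j 1)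
  rw [key] at h1 h2
  rw [abs_le]
  constructor <;> linarith

theorem norm_e {n : ℕ} (i : Fin n) : ‖(e i : E n)‖ = 1 := by simp [e]

theorem abs_fderiv_e_le {n : ℕ} (f : E n → ℝ) (x : E n) (i : Fin n) :
    |fderiv ℝ f x (e i)| ≤ ‖fderiv ℝ f x‖ := by
  have := (fderiv ℝ f x).le_opNorm (e i)
  rwa [norm_e, mul_one] at this

theorem fderiv_comp_sub_left {n : ℕ} {ρ : E n → ℝ} (hρ : ContDiff ℝ ∞ ρ)
    (x y v : E n) :
    fderiv ℝ (fun y => ρ (x - y)) y v = -fderiv ℝ ρ (x - y) v := by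
  have h1 := ((hρ.differentiable (by simp)) (x - y)).hasFDerivAt.comp y
    ((hasFDerivAt_id y).const_sub x)
  have h2 : fderiv ℝ (fun y => ρ (x - y)) y = _ := h1.fderiv
  rw [h2]
  simp

theorem isTestFunction_comp_sub {n : ℕ} {D : Set (E n)} {ρ : E n → ℝ} {ε : ℝ} {x : E n}
    (hρ : ContDiff ℝ ∞ ρ) (hc : HasCompactSupport ρ)
    (hs : Function.support ρ ⊆ Metric.ball 0 ε) (hx : Metric.closedBall x ε ⊆ D) :
    IsTestFunction D (fun y => ρ (x - y)) where
  contDiff := hρ.comp (contDiff_const.sub contDiff_id)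
  hasCompactSupport := hc.comp_homeomorph (Homeomorph.subLeft x)
  tsupport_subset := by
    refine (closure_minimal (fun y hy => ?_) Metric.isClosed_closedBall).trans hx
    have := hs (show x - y ∈ Function.support ρ from hy)
    rw [mem_ball_zero_iff] at this
    rw [Metric.mem_closedBall, dist_comm, dist_eq_norm]
    exact this.le

theorem integral_indicator_mul {n : ℕ} {D : Set (E n)} (hD : MeasurableSet D) (f φ : E n → ℝ) :
    ∫ x, D.indicator f x * φ x = ∫ x in D, f x * φ x := by
  rw [← integral_indicator hD]
  congr 1
  ext x
  by_cases hx : x ∈ D <;> simp [hx]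

/-- The mollified derivatives commute. -/
theorem fderiv_conv_weakDeriv_comm {n : ℕ} {D : Set (E n)} (hD : IsOpen D) {w : E n → ℝ}
    {G : Fin n → E n → ℝ} (hG : ∀ j, HasWeakDeriv D ![j] w (G j))
    (hG2 : ∀ j, MemLp (G j) 2 (volume.restrict D)) {ρ : E n → ℝ} {ε : ℝ} {x : E n}
    (hρ : ContDiff ℝ ∞ ρ) (hc : HasCompactSupport ρ)
    (hs : Function.support ρ ⊆ Metric.ball 0 ε) (hx : Metric.closedBall x ε ⊆ D) (k i : Fin n) :
    fderiv ℝ (conv (D.indicator (G i)) ρ) x (e k) =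
      fderiv ℝ (conv (D.indicator (G k)) ρ) x (e i) := by
  have hφ := isTestFunction_comp_sub hρ hc hs hx
  -- Testing the definition of `G i` with `∂_k` of `ρ (x - ·)` moves all derivatives onto the
  -- kernel; the sign of the weak derivative cancels that of the reflection.
  have key : ∀ i k, fderiv ℝ (conv (D.indicator (G i)) ρ) x (e k) =
      ∫ y in D, w y * fderiv ℝ (fun z => fderiv ℝ (fun y => ρ (x - y)) z (e k)) y (e i) := by
    intro i k
    have h1 := (hG i).integral_eq _ (hφ.fderiv_apply (e k))
    simp only [classicalDeriv_one, Matrix.cons_val_zero, pow_one, neg_mul, one_mul] at h1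
    rw [h1, fderiv_conv (locallyIntegrable_of_memLp_two
      ((memLp_indicator_iff_restrict hD.measurableSet).mpr (hG2 i))) hρ hc,
      integral_indicator_mul hD.measurableSet, ← integral_neg]
    simp_rw [fderiv_comp_sub_left hρ, mul_neg, neg_neg]
  rw [key, key]
  simp_rw [fderiv_fderiv_comm hφ.contDiff _ (e k) (e i)]

/-- The Lipschitz bound supplies measurability of the coefficients on `D`, and the entry bound
supplies the norm estimate. -/
theorem memLp_coeff_mul {n : ℕ} {D : Set (E n)} (hD : IsOpen D)
    {a : E n → Matrix (Fin n) (Fin n) ℝ} {Lam r : ℝ} {G : Fin n → E n → ℝ}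
    (ha : ∀ x ∈ D, ∀ i j, |a x i j| ≤ Lam)
    (hL : ∀ x ∈ D, ∀ y ∈ D, ‖a x - a y‖ ≤ (1 / r) * ‖x - y‖)
    (hG2 : ∀ j, MemLp (G j) 2 (volume.restrict D)) (i : Fin n) :
    MemLp (D.indicator fun x => ∑ j, a x i j * G j x) 2 := by
  rw [memLp_indicator_iff_restrict hD.measurableSet]
  refine memLp_finsetSum _ fun j _ => ?_
  have hcont : ContinuousOn (fun x => a x i j) D := by
    have : LipschitzOnWith (Real.toNNReal (1 / r)) (fun x => a x i j) D := by
      refine LipschitzOnWith.of_dist_le_mul fun x hx y hy => ?_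
      calc dist (a x i j) (a y i j) = |(a x - a y) i j| := rfl
        _ ≤ (1 / r) * ‖x - y‖ := (abs_entry_le_frobenius_norm _ i j).trans (hL x hx y hy)
        _ ≤ Real.toNNReal (1 / r) * dist x y := by
          rw [dist_eq_norm]
          gcongr
          exact Real.le_coe_toNNReal _
    exact this.continuousOn
  refine (hG2 j).of_le_mul (c := Lam)
    ((hcont.aestronglyMeasurable hD.measurableSet).mul (hG2 j).1) ?_
  filter_upwards [ae_restrict_mem hD.measurableSet] with x hx
  rw [norm_mul]
  gcongr
  exact ha x hx i j

/-- The mollified flux has divergence `-g`, mollified. -/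
theorem sum_fderiv_conv_flux {n : ℕ} {D : Set (E n)} (hD : IsOpen D)
    {a : E n → Matrix (Fin n) (Fin n) ℝ} {g : E n → ℝ} {G : Fin n → E n → ℝ}
    (hB : ∀ i, MemLp (D.indicator fun x => ∑ j, a x i j * G j x) 2)
    (heq : ∀ φ : E n → ℝ, IsTestFunction D φ →
      ∫ x in D, (a x *ᵥ fun j => G j x) ⬝ᵥ grad φ x = ∫ x in D, g x * φ x)
    {ρ : E n → ℝ} {ε : ℝ} {x : E n}
    (hρ : ContDiff ℝ ∞ ρ) (hc : HasCompactSupport ρ)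
    (hs : Function.support ρ ⊆ Metric.ball 0 ε) (hx : Metric.closedBall x ε ⊆ D) :
    ∑ i, fderiv ℝ (conv (D.indicator fun x => ∑ j, a x i j * G j x) ρ) x (e i) =
      -conv (D.indicator g) ρ x := by
  have h1 := heq _ (isTestFunction_comp_sub hρ hc hs hx)
  rw [conv_apply, integral_indicator_mul hD.measurableSet, ← h1]
  simp_rw [fderiv_conv (locallyIntegrable_of_memLp_two (hB _)) hρ hc]
  rw [← integral_finsetSum _ fun i _ => integrable_mul_comp_sub
      (locallyIntegrable_of_memLp_two (hB i)) (contDiff_fderiv_apply hρ (e i)).continuous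
      (hc.fderiv_apply ℝ (e i)) x, ← integral_neg, ← integral_indicator hD.measurableSet]
  congr 1
  ext y
  by_cases hy : y ∈ D
  · simp [hy, grad, dotProduct, Matrix.mulVec, fderiv_comp_sub_left hρ]
  · simp [hy]

/-- The commutator of mollification and multiplication by a Lipschitz coefficient. -/
theorem abs_fderiv_conv_flux_sub_le {n : ℕ} {D : Set (E n)} (hD : IsOpen D)
    {a : E n → Matrix (Fin n) (Fin n) ℝ} {r : ℝ} (hr : 0 < r) {G : Fin n → E n → ℝ}
    (hL : ∀ x ∈ D, ∀ y ∈ D, ‖a x - a y‖ ≤ (1 / r) * ‖x - y‖)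
    (hG2 : ∀ j, MemLp (G j) 2 (volume.restrict D))
    (hB : ∀ i, MemLp (D.indicator fun x => ∑ j, a x i j * G j x) 2)
    {ρ : E n → ℝ} {ε : ℝ} {x : E n}
    (hρ : ContDiff ℝ ∞ ρ) (hc : HasCompactSupport ρ) (hε : 0 < ε)
    (hs : Function.support ρ ⊆ Metric.ball 0 ε) (hx : Metric.closedBall x ε ⊆ D) (k i : Fin n) :
    |fderiv ℝ (conv (D.indicator fun x => ∑ j, a x i j * G j x) ρ) x (e k) -
      ∑ j, a x i j * fderiv ℝ (conv (D.indicator (G j)) ρ) x (e k)| ≤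
      (1 / r) * conv (fun y => ∑ j, |D.indicator (G j) y|) (fun z => ‖z‖ * ‖fderiv ℝ ρ z‖) x := by
  have hGI : ∀ j, LocallyIntegrable (D.indicator (G j)) := fun j =>
    locallyIntegrable_of_memLp_two ((memLp_indicator_iff_restrict hD.measurableSet).mpr (hG2 j))
  have hd := (contDiff_fderiv_apply hρ (e k)).continuous
  have hdc := hc.fderiv_apply ℝ (e k)
  have hN : LocallyIntegrable (fun y => ∑ j, |D.indicator (G j) y|) :=
    locallyIntegrable_finsetSum _ fun j _ y => (hGI j y).norm
  have hkc : Continuous (fun z : E n => ‖z‖ * ‖fderiv ℝ ρ z‖) :=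
    continuous_norm.mul (hρ.continuous_fderiv (by simp)).norm
  have hks : HasCompactSupport (fun z : E n => ‖z‖ * ‖fderiv ℝ ρ z‖) :=
    (hc.fderiv ℝ).norm.mul_left
  have hj : ∀ j, Integrable (fun y => a x i j * (D.indicator (G j) y * fderiv ℝ ρ (x - y) (e k))) :=
    fun j => (integrable_mul_comp_sub (hGI j) hd hdc x).const_mul _
  rw [fderiv_conv (locallyIntegrable_of_memLp_two (hB i)) hρ hc]
  simp_rw [fderiv_conv (hGI _) hρ hc, ← integral_const_mul]
  rw [← integral_finsetSum _ fun j _ => hj j, ← integral_sub (integrable_mul_comp_sub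
    (locallyIntegrable_of_memLp_two (hB i)) hd hdc x) (integrable_finsetSum _ fun j _ => hj j),
    conv_apply, ← integral_const_mul]
  rw [← Real.norm_eq_abs]
  refine norm_integral_le_of_norm_le ((integrable_mul_comp_sub hN hkc hks x).const_mul _)
    (ae_of_all _ fun y => ?_)
  by_cases hy : x - y ∈ tsupport ρ
  · have hy' : x - y ∈ Metric.closedBall (0 : E n) ε :=
      closure_minimal (hs.trans Metric.ball_subset_closedBall) Metric.isClosed_closedBall hy
    have hyD : y ∈ D := hx (by
      rw [mem_closedBall_zero_iff] at hy'
      rwa [Metric.mem_closedBall, dist_comm, dist_eq_norm])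
    have hxD : x ∈ D := hx (Metric.mem_closedBall_self hε.le)
    simp only [indicator_of_mem hyD]
    -- The derivative falls on `ρ` in both terms, so only `a y - a x` remains. Its size `‖x - y‖ /
    -- r` compensates the singularity of `Dρ`, and `a` is never differentiated.
    have h1 : (∑ j, a y i j * G j y) * fderiv ℝ ρ (x - y) (e k) -
        ∑ j, a x i j * (G j y * fderiv ℝ ρ (x - y) (e k)) =
        (∑ j, (a y - a x) i j * G j y) * fderiv ℝ ρ (x - y) (e k) := by
      rw [Finset.sum_mul, Finset.sum_mul, ← Finset.sum_sub_distrib]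
      refine Finset.sum_congr rfl fun j _ => ?_
      rw [Matrix.sub_apply]
      ring
    have h2 : |∑ j, (a y - a x) i j * G j y| ≤ 1 / r * ‖x - y‖ * ∑ j, |G j y| := by
      rw [Finset.mul_sum]
      refine (Finset.abs_sum_le_sum_abs _ _).trans (Finset.sum_le_sum fun j _ => ?_)
      rw [abs_mul]
      gcongr
      refine (abs_entry_le_frobenius_norm _ i j).trans ((hL y hyD x hxD).trans_eq ?_)
      rw [norm_sub_rev]
    rw [h1, norm_mul, Real.norm_eq_abs, Real.norm_eq_abs]
    calc _ ≤ (1 / r * ‖x - y‖ * ∑ j, |G j y|) * ‖fderiv ℝ ρ (x - y)‖ := by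
          gcongr
          exact abs_fderiv_e_le _ _ _
      _ = _ := by ring
  · have h0 : fderiv ℝ ρ (x - y) = 0 := image_eq_zero_of_notMem_tsupport
      fun h => hy (tsupport_fderiv_subset ℝ h)
    simp [h0]

/-- The interior estimate for the mollified weak gradient, uniform in the mollifier. -/
theorem exists_mollified_estimate (n : ℕ) (lam Lam c : ℝ) (hlam : 0 < lam) (hLam : 0 ≤ Lam) :
    ∃ C : ℝ, 0 ≤ C ∧ ∀ (D : Set (E n)) (a : E n → Matrix (Fin n) (Fin n) ℝ) (g w η ρ : E n → ℝ)
      (G : Fin n → E n → ℝ) (r M ε : ℝ), IsOpen D → IsElliptic lam Lam D a → 0 < r →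
      (∀ x ∈ D, ∀ y ∈ D, ‖a x - a y‖ ≤ (1 / r) * ‖x - y‖) →
      MemLp g 2 (volume.restrict D) → (∀ j, HasWeakDeriv D ![j] w (G j)) →
      (∀ j, MemLp (G j) 2 (volume.restrict D)) →
      (∀ φ : E n → ℝ, IsTestFunction D φ →
        ∫ x in D, (a x *ᵥ fun j => G j x) ⬝ᵥ grad φ x = ∫ x in D, g x * φ x) →
      0 ≤ M → ContDiff ℝ ∞ η → HasCompactSupport η → (∀ x, 0 ≤ η x) → (∀ x, η x ≤ 1) →
      (∀ x i, |fderiv ℝ η x (e i)| ≤ M) → ContDiff ℝ ∞ ρ → HasCompactSupport ρ → (∀ x, 0 ≤ ρ x) →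
      ∫ x, ρ x = 1 → 0 < ε → Function.support ρ ⊆ Metric.ball 0 ε →
      ∫ z, ‖z‖ * ‖fderiv ℝ ρ z‖ ≤ c → (∀ x ∈ tsupport η, Metric.closedBall x ε ⊆ D) →
      ∫ x, η x ^ 2 * ∑ k, ∑ i, fderiv ℝ (conv (D.indicator (G i)) ρ) x (e k) ^ 2 ≤
        C * (((1 / r) ^ 2 + M ^ 2) * (∑ j, ∫ x in D, G j x ^ 2) + ∫ x in D, g x ^ 2) := by
  obtain ⟨C, hC, hest⟩ := exists_energy_estimate n lam Lam hlam hLam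
  -- `c ^ 2` bounds the squared mass of the commutator kernel, `1` that of `ρ`, and `n` comes from
  -- `(∑ |G_j|)² ≤ n ∑ G_j²`; the final `1` belongs to `g`.
  refine ⟨C * ((c ^ 2 + 1) * n + 1), by positivity, ?_⟩
  intro D a g w η ρ G r M ε hD ha hr hL hg hG hG2 heq hM hη hηc hη0 hη1 hηM hρ hc hρ0 hρ1 hε hs
    hρc hηD
  have hmD := hD.measurableSet
  have hB := memLp_coeff_mul hD (fun x hx => ha.abs_entry_le hlam hx) hL hG2
  have hGI : ∀ j, MemLp (D.indicator (G j)) 2 := fun j =>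
    (memLp_indicator_iff_restrict hmD).mpr (hG2 j)
  have hgI : MemLp (D.indicator g) 2 := (memLp_indicator_iff_restrict hmD).mpr hg
  have hN : MemLp (fun y => ∑ j, |D.indicator (G j) y|) 2 :=
    memLp_finsetSum _ fun j _ => (hGI j).norm
  have hkc : Continuous (fun z : E n => ‖z‖ * ‖fderiv ℝ ρ z‖) :=
    continuous_norm.mul (hρ.continuous_fderiv (by simp)).norm
  have hks : HasCompactSupport (fun z : E n => ‖z‖ * ‖fderiv ℝ ρ z‖) :=
    (hc.fderiv ℝ).norm.mul_left
  obtain ⟨yV, yV'⟩ := integral_conv_sq_le hN hρ0 hρ.continuous hc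
  obtain ⟨yκ, yκ'⟩ := integral_conv_sq_le hN (fun z => by positivity) hkc hks
  obtain ⟨yg, yg'⟩ := integral_conv_sq_le hgI hρ0 hρ.continuous hc
  have hN0 : ∀ y, 0 ≤ ∑ j, |D.indicator (G j) y| := fun y =>
    Finset.sum_nonneg fun j _ => abs_nonneg _
  have main := hest a (fun i => conv (D.indicator (G i)) ρ)
    (fun i => conv (D.indicator fun x => ∑ j, a x i j * G j x) ρ) η (conv (D.indicator g) ρ)
    (conv (fun y => ∑ j, |D.indicator (G j) y|) ρ)
    (fun x => (1 / r) *
      conv (fun y => ∑ j, |D.indicator (G j) y|) (fun z => ‖z‖ * ‖fderiv ℝ ρ z‖) x)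
    M hM hη hηc hη0 hη1 hηM
    (fun k => contDiff_conv (locallyIntegrable_of_memLp_two (hGI k)) hρ hc)
    (fun k => contDiff_conv (locallyIntegrable_of_memLp_two (hB k)) hρ hc)
    (continuous_conv (locallyIntegrable_of_memLp_two hgI) hρ.continuous hc) yg yV
    (by simpa only [mul_pow] using yκ.const_mul ((1 / r) ^ 2))
    (fun x => integral_nonneg fun y => mul_nonneg (hN0 y) (hρ0 _))
    (fun x => mul_nonneg (by positivity)
      (integral_nonneg fun y => mul_nonneg (hN0 y) (by positivity)))
    (fun x hx => by
      have hxD : x ∈ D := hηD x hx (Metric.mem_closedBall_self hε.le)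
      refine ⟨ha.lower x hxD, ha.abs_entry_le hlam hxD,
        fderiv_conv_weakDeriv_comm hD hG hG2 hρ hc hs (hηD x hx),
        sum_fderiv_conv_flux hD hB heq hρ hc hs (hηD x hx), fun i => ?_,
        abs_fderiv_conv_flux_sub_le hD hr hL hG2 hB hρ hc hε hs (hηD x hx)⟩
      rw [← Real.norm_eq_abs]
      refine norm_integral_le_of_norm_le (integrable_mul_comp_sub
        (locallyIntegrable_of_memLp_two hN) hρ.continuous hc x) (ae_of_all _ fun y => ?_)
      rw [ContinuousLinearMap.mul_apply', norm_mul, Real.norm_of_nonneg (hρ0 _)]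
      exact mul_le_mul_of_nonneg_right (Finset.single_le_sum
        (f := fun j => |D.indicator (G j) y|) (fun j _ => abs_nonneg _) (Finset.mem_univ i)) (hρ0 _))
  simp only [mul_pow, integral_const_mul] at main
  rw [hρ1, one_pow, one_mul] at yV' yg'
  have hsq : ∀ f : E n → ℝ, ∫ x, D.indicator f x ^ 2 = ∫ x in D, f x ^ 2 := by
    intro f
    rw [← integral_indicator hmD]
    congr 1
    ext x
    by_cases hx : x ∈ D <;> simp [hx]
  have hNle : ∫ y, (∑ j, |D.indicator (G j) y|) ^ 2 ≤ n * ∑ j, ∫ x in D, G j x ^ 2 := by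
    simp_rw [← hsq]
    rw [← integral_finsetSum _ fun j _ => (hGI j).integrable_sq, ← integral_const_mul]
    refine integral_mono hN.integrable_sq
      ((integrable_finsetSum _ fun j _ => (hGI j).integrable_sq).const_mul _) fun y => ?_
    have := sq_sum_le_card_mul_sum_sq (s := Finset.univ) (f := fun j => |D.indicator (G j) y|)
    simpa using this
  have hκ2 : (∫ z, ‖z‖ * ‖fderiv ℝ ρ z‖) ^ 2 ≤ c ^ 2 := by
    gcongr
  rw [hsq] at yg'
  set S := ∑ j, ∫ x in D, G j x ^ 2 with hS
  have hS0 : 0 ≤ S := Finset.sum_nonneg fun j _ => integral_nonneg fun x => sq_nonneg _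
  have hg0 : 0 ≤ ∫ x in D, g x ^ 2 := integral_nonneg fun x => sq_nonneg _
  refine main.trans ?_
  rw [mul_assoc]
  gcongr
  calc _ ≤ (1 / r) ^ 2 * (c ^ 2 * (n * S)) + M ^ 2 * (n * S) + ∫ x in D, g x ^ 2 := by
        gcongr
        · refine yκ'.trans ?_
          gcongr
        · exact yV'.trans hNle
    _ ≤ _ := by
        have : 0 ≤ M ^ 2 * (c ^ 2 * (n * S)) + (1 / r) ^ 2 * (n * S) +
            ((1 / r) ^ 2 + M ^ 2) * S + (c ^ 2 + 1) * n * ∫ x in D, g x ^ 2 := by positivity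
        linarith

/-! ### Distance to the boundary and cutoff functions -/

/-- Points at distance less than `dist(D', ∂D)` from `D' ⊆ D` belong to `D`. -/
theorem mem_of_dist_lt_setDist {n : ℕ} {D D' : Set (E n)} {d : ℝ}
    (hD : IsOpen D) (hD' : D' ⊆ D) (hd : ENNReal.ofReal d < setDist D' (frontier D)) {p x : E n}
    (hp : p ∈ D') (hx : dist p x ≤ d) : x ∈ D := by
  by_contra hxD
  -- Otherwise `D` and the complement of `closure D` would disconnect the segment.
  obtain ⟨q, hq, hqf⟩ : (segment ℝ p x ∩ frontier D).Nonempty := by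
    by_contra hne
    have hcl : ∀ q ∈ segment ℝ p x, q ∉ D → q ∉ closure D := fun q hq hqD hqc =>
      hne ⟨q, hq, hD.frontier_eq ▸ ⟨hqc, hqD⟩⟩
    obtain ⟨q, -, hqD, hqc⟩ := (convex_segment p x).isPreconnected D (closure D)ᶜ hD
      isClosed_closure.isOpen_compl (fun q hq => or_iff_not_imp_left.mpr (hcl q hq))
      ⟨p, left_mem_segment ℝ p x, hD' hp⟩
      ⟨x, right_mem_segment ℝ p x, hcl x (right_mem_segment ℝ p x) hxD⟩
    exact hqc (subset_closure hqD)
  have h1 : dist p q ≤ d := by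
    have := dist_add_dist_of_mem_segment hq
    linarith [dist_nonneg (x := q) (y := x)]
  have h2 : setDist D' (frontier D) ≤ edist p q :=
    (iInf₂_le p hp).trans (iInf₂_le q hqf)
  refine absurd (hd.trans_le h2) (not_lt.mpr ?_)
  rw [edist_dist]
  exact ENNReal.ofReal_le_ofReal h1

/-- Some closed thickening of the compact set `closure D'` stays inside `D`, and the open set `D`
misses its own frontier. -/
theorem setDist_frontier_pos {n : ℕ} {D D' : Set (E n)} (hD : IsOpen D)
    (hc : IsCompact (closure D')) (hs : closure D' ⊆ D) : 0 < setDist D' (frontier D) := by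
  obtain ⟨δ, hδ, h⟩ := hc.exists_cthickening_subset_open hD hs
  refine (ENNReal.ofReal_pos.mpr hδ).trans_le (le_iInf₂ fun x hx => le_iInf₂ fun y hy => ?_)
  by_contra hlt
  have hyD : y ∈ D := h (Metric.mem_cthickening_of_edist_le y x δ _ (subset_closure hx) (by
    rw [edist_comm]
    exact (not_le.mp hlt).le))
  exact (hD.frontier_eq ▸ hy).2 hyD

/-- A smooth cutoff function with gradient bounded by the inverse distance to the boundary. -/
theorem exists_cutoff {n : ℕ} {D D' : Set (E n)} (hD : IsOpen D)
    (hc : IsCompact (closure D')) (hs : D' ⊆ D) {d : ℝ}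
    (hd0 : 0 < d) (hd : ENNReal.ofReal d < setDist D' (frontier D)) :
    ∃ η : E n → ℝ, ContDiff ℝ ∞ η ∧ HasCompactSupport η ∧ tsupport η ⊆ D ∧ (∀ x, 0 ≤ η x) ∧
      (∀ x, η x ≤ 1) ∧ (∀ x ∈ D', η x = 1) ∧ ∀ x i, |fderiv ℝ η x (e i)| ≤ 4 / d := by
  -- `Metric.infDist` to the empty set is `0`, so the construction below would give the constant
  -- `1`, which need not have compact support.
  rcases D'.eq_empty_or_nonempty with rfl | hne
  · refine ⟨fun _ => 0, contDiff_const, HasCompactSupport.zero, by simp [tsupport], by simp,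
      by simp, by simp, fun x i => ?_⟩
    simp only [fderiv_fun_const, Pi.zero_apply, zero_apply, abs_zero]
    positivity
  obtain ⟨_, -, hmol⟩ := exists_mollifier n
  obtain ⟨ρ, hρ, hρc, hρ0, hρ1, hρs, -⟩ := hmol (d / 4) (by positivity)
  -- `f` is `1` up to distance `d / 4` from `D'`, is `0` from distance `d / 2` on, and has Lipschitz
  -- constant `4 / d`. Mollifying at scale `d / 4` keeps the value `1` on `D'` and the Lipschitz
  -- constant, and leaves the support within distance `3 * d / 4`.
  let f : E n → ℝ := fun x => max (min (2 - 4 / d * Metric.infDist x D') 1) 0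
  have hf0 : ∀ x, 0 ≤ f x := fun x => le_max_right _ _
  have hf1 : ∀ x, f x ≤ 1 := fun x => max_le (min_le_right _ _) zero_le_one
  have hfL : ∀ x y, |f x - f y| ≤ 4 / d * dist x y := by
    intro x y
    refine (abs_sup_sub_sup_le_abs _ _ _).trans ?_
    refine (abs_inf_sub_inf_le_abs _ _ _).trans ?_
    rw [sub_sub_sub_cancel_left, ← mul_sub, abs_mul, abs_of_pos (by positivity : 0 < 4 / d),
      abs_sub_comm]
    gcongr
    have := (Metric.lipschitz_infDist_pt D').dist_le_mul x y
    simpa [Real.dist_eq] using this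
  have hfc : Continuous f := by
    have := Metric.continuous_infDist_pt D'
    fun_prop
  have hfl : LocallyIntegrable f := hfc.locallyIntegrable
  have hη : ∀ x, conv f ρ x = ∫ z, ρ z * f (x - z) := fun x => by rw [conv_comm, conv_apply]
  have hint : ∀ x, Integrable (fun z => ρ z * f (x - z)) := fun x =>
    (hρ.continuous.mul (hfc.comp (continuous_const.sub continuous_id))).integrable_of_hasCompactSupport
      hρc.mul_right
  have hρi : Integrable ρ := hρ.continuous.integrable_of_hasCompactSupport hρc
  have hzero : Function.support (conv f ρ) ⊆ {x | Metric.infDist x D' ≤ 3 * d / 4} := by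
    intro x hx
    by_contra hlt
    rw [mem_ofPred_eq, not_le] at hlt
    refine hx ?_
    rw [hη]
    refine integral_eq_zero_of_ae (ae_of_all _ fun z => ?_)
    by_cases hz : ρ z = 0
    · simp [hz]
    have hz' := mem_ball_zero_iff.mp (hρs hz)
    have h1 : Metric.infDist x D' ≤ Metric.infDist (x - z) D' + dist x (x - z) :=
      Metric.infDist_le_infDist_add_dist
    rw [dist_self_sub_right] at h1
    have h2 : f (x - z) = 0 := by
      refine max_eq_right ((min_le_left _ _).trans ?_)
      have h3 : d / 2 ≤ Metric.infDist (x - z) D' := by linarith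
      have h4 : 4 / d * (d / 2) ≤ 4 / d * Metric.infDist (x - z) D' := by gcongr
      have h5 : 4 / d * (d / 2) = 2 := by field_simp; norm_num
      linarith
    simp [h2]
  have hcl : IsClosed {x : E n | Metric.infDist x D' ≤ 3 * d / 4} :=
    isClosed_le (Metric.continuous_infDist_pt D') continuous_const
  have hts : tsupport (conv f ρ) ⊆ {x | Metric.infDist x D' ≤ 3 * d / 4} :=
    closure_minimal hzero hcl
  have hnear : ∀ x, Metric.infDist x D' ≤ 3 * d / 4 → ∃ p ∈ D', dist x p < d := fun x hx =>
    (Metric.infDist_lt_iff hne).mp (by linarith)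
  refine ⟨conv f ρ, contDiff_conv hfl hρ hρc, ?_, ?_, ?_, ?_, ?_, ?_⟩
  · refine (hc.cthickening (r := d)).of_isClosed_subset (isClosed_tsupport _) fun x hx => ?_
    obtain ⟨p, hp, hxp⟩ := hnear x (hts hx)
    exact Metric.mem_cthickening_of_dist_le x p d _ (subset_closure hp) hxp.le
  · intro x hx
    obtain ⟨p, hp, hxp⟩ := hnear x (hts hx)
    exact mem_of_dist_lt_setDist hD hs hd hp (by rw [dist_comm]; exact hxp.le)
  · intro x
    rw [hη]
    exact integral_nonneg fun z => mul_nonneg (hρ0 z) (hf0 _)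
  · intro x
    rw [hη, ← hρ1]
    exact integral_mono (hint x) hρi fun z => mul_le_of_le_one_right (hρ0 z) (hf1 _)
  · intro x hx
    rw [hη, ← hρ1]
    congr 1
    ext z
    by_cases hz : ρ z = 0
    · simp [hz]
    have hz' := mem_ball_zero_iff.mp (hρs hz)
    have h1 : Metric.infDist (x - z) D' ≤ d / 4 := by
      refine (Metric.infDist_le_dist_of_mem hx).trans ?_
      rw [dist_comm, dist_self_sub_right]
      exact hz'.le
    have h2 : f (x - z) = 1 := by
      have h4 : 4 / d * Metric.infDist (x - z) D' ≤ 4 / d * (d / 4) := by gcongr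
      have h5 : 4 / d * (d / 4) = 1 := by field_simp
      simp only [f]
      rw [min_eq_right (by linarith), max_eq_left zero_le_one]
    rw [h2, mul_one]
  · intro x i
    refine (abs_fderiv_e_le _ x i).trans ?_
    have hL : LipschitzWith (Real.toNNReal (4 / d)) (conv f ρ) := by
      refine LipschitzWith.of_dist_le_mul fun x y => ?_
      rw [Real.coe_toNNReal _ (by positivity), Real.dist_eq, hη, hη,
        ← integral_sub (hint x) (hint y), ← one_mul (4 / d), ← hρ1, mul_assoc,
        ← integral_mul_const, ← Real.norm_eq_abs]
      refine norm_integral_le_of_norm_le (hρi.mul_const _) (ae_of_all _ fun z => ?_)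
      rw [← mul_sub, norm_mul, Real.norm_of_nonneg (hρ0 z), Real.norm_eq_abs]
      refine mul_le_mul_of_nonneg_left ((hfL _ _).trans_eq ?_) (hρ0 z)
      rw [dist_sub_right]
    have := norm_fderiv_le_of_lipschitz ℝ (x₀ := x) hL
    rwa [Real.coe_toNNReal _ (by positivity)] at this

/-! ### Weak derivatives: restriction, uniqueness, existence in `L²` -/

theorem HasWeakDeriv.mono {n k : ℕ} {D D' : Set (E n)} {m : Fin k → Fin n} {u v : E n → ℝ}
    (h : HasWeakDeriv D m u v) (hD : IsOpen D) (hs : D' ⊆ D) : HasWeakDeriv D' m u v where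
  locallyIntegrableOn := h.locallyIntegrableOn.mono_set hs
  locallyIntegrableOn_deriv := h.locallyIntegrableOn_deriv.mono_set hs
  integral_eq φ hφ := by
    have h0 : ∀ x ∉ D', φ x = 0 := fun x hx =>
      image_eq_zero_of_notMem_tsupport fun h => hx (hφ.tsupport_subset h)
    have h1 : ∀ x ∉ D', classicalDeriv m φ x = 0 := fun x hx => by
      rw [classicalDeriv, image_eq_zero_of_notMem_tsupport fun h' =>
        hx (hφ.tsupport_subset (tsupport_iteratedFDeriv_subset k h'))]
      rfl
    have key := h.integral_eq φ (hφ.mono hs)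
    rwa [setIntegral_eq_of_subset_of_forall_sdiff_eq_zero hD.measurableSet hs
        fun x hx => by rw [h1 x hx.2, mul_zero],
      setIntegral_eq_of_subset_of_forall_sdiff_eq_zero hD.measurableSet hs
        fun x hx => by rw [h0 x hx.2, mul_zero]] at key

theorem LocallyIntegrableOn.integrable_mul_testFunction {n : ℕ} {D : Set (E n)} {v φ : E n → ℝ}
    (hv : LocallyIntegrableOn v D) (hφ : IsTestFunction D φ) :
    IntegrableOn (fun x => v x * φ x) D := by
  have h1 : IntegrableOn v (tsupport φ) :=
    (hv.mono_set hφ.tsupport_subset).integrableOn_isCompact hφ.hasCompactSupport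
  have h2 : IntegrableOn (fun x => v x * φ x) (tsupport φ) :=
    h1.mul_continuousOn hφ.contDiff.continuous.continuousOn hφ.hasCompactSupport
  refine ((integrableOn_iff_integrable_of_support_subset fun x hx => ?_).mp h2).integrableOn
  exact subset_tsupport φ fun h => hx (by simp [h])

/-- The fundamental lemma of the calculus of variations applied to `v - v'`. It makes the choice of
representative in `weakDeriv` harmless. -/
theorem HasWeakDeriv.ae_eq {n k : ℕ} {D : Set (E n)} {m : Fin k → Fin n} {u v v' : E n → ℝ}
    (hD : IsOpen D) (h : HasWeakDeriv D m u v) (h' : HasWeakDeriv D m u v') :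
    v =ᵐ[volume.restrict D] v' := by
  have key := hD.ae_eq_zero_of_integral_contDiff_smul_eq_zero (μ := volume)
    (h.locallyIntegrableOn_deriv.sub h'.locallyIntegrableOn_deriv) fun φ hφ hφc hφs => by
      have hφt : IsTestFunction D φ := ⟨hφ, hφc, hφs⟩
      have h1 := h.integral_eq φ hφt
      rw [h'.integral_eq φ hφt] at h1
      have h2 := mul_left_cancel₀ (pow_ne_zero k (by norm_num : (-1 : ℝ) ≠ 0)) h1
      have h3 : ∫ x in D, v x * φ x - v' x * φ x = 0 := by
        rw [integral_sub
          (LocallyIntegrableOn.integrable_mul_testFunction h.locallyIntegrableOn_deriv hφt)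
          (LocallyIntegrableOn.integrable_mul_testFunction h'.locallyIntegrableOn_deriv hφt),
          h2, sub_self]
      rw [← h3, ← integral_indicator hD.measurableSet]
      congr 1
      ext x
      by_cases hx : x ∈ D
      · simp [hx]
        ring
      · simp [hx, image_eq_zero_of_notMem_tsupport fun h => hx (hφs h)]
  rw [EventuallyEq, ae_restrict_iff' hD.measurableSet]
  filter_upwards [key] with x hx hxD
  exact sub_eq_zero.mp (hx hxD)

theorem HasWeakDeriv.weakDeriv {n k : ℕ} {D : Set (E n)} {m : Fin k → Fin n} {u v : E n → ℝ}
    (h : HasWeakDeriv D m u v) : HasWeakDeriv D m u (weakDeriv D m u) := by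
  have hex : ∃ v, HasWeakDeriv D m u v := ⟨v, h⟩
  rw [InteriorH2.weakDeriv, dif_pos hex]
  exact hex.choose_spec

theorem eLpNorm_two_eq {α : Type*} [MeasurableSpace α] {μ : Measure α} {f : α → ℝ}
    (hf : MemLp f 2 μ) : eLpNorm f 2 μ = ENNReal.ofReal (Real.sqrt (∫ x, f x ^ 2 ∂μ)) := by
  rw [hf.eLpNorm_eq_integral_rpow_norm (by norm_num) (by norm_num), Real.sqrt_eq_rpow]
  simp

theorem abs_integral_mul_le_sqrt {α : Type*} [MeasurableSpace α] {μ : Measure α} {f g : α → ℝ}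
    (hf : MemLp f 2 μ) (hg : MemLp g 2 μ) :
    |∫ x, f x * g x ∂μ| ≤ Real.sqrt (∫ x, f x ^ 2 ∂μ) * Real.sqrt (∫ x, g x ^ 2 ∂μ) := by
  have hfg : Integrable (fun x => f x * g x) μ := hf.integrable_mul hg
  have h : ∀ t : ℝ, 0 ≤ (∫ x, g x ^ 2 ∂μ) * (t * t) + (-2 * ∫ x, f x * g x ∂μ) * t +
      ∫ x, f x ^ 2 ∂μ := by
    intro t
    have h0 : 0 ≤ ∫ x, (t * t) * g x ^ 2 + (-2 * t) * (f x * g x) + f x ^ 2 ∂μ :=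
      integral_nonneg fun x => by
        have := sq_nonneg (f x - t * g x)
        simp only [Pi.zero_apply]
        linarith
    have h1 : Integrable (fun x => t * t * g x ^ 2 + -2 * t * (f x * g x)) μ :=
      (hg.integrable_sq.const_mul _).add (hfg.const_mul _)
    rw [integral_add h1 hf.integrable_sq, integral_add (hg.integrable_sq.const_mul _)
      (hfg.const_mul _), integral_const_mul, integral_const_mul] at h0
    linarith
  have := discrim_le_zero h
  rw [discrim] at this
  rw [← Real.sqrt_mul (integral_nonneg fun x => sq_nonneg _)]
  exact Real.abs_le_sqrt (by linarith)

theorem IsTestFunction.memLp {n : ℕ} {D : Set (E n)} {φ : E n → ℝ} (hφ : IsTestFunction D φ)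
    (μ : Measure (E n)) [IsLocallyFiniteMeasure μ] : MemLp φ 2 μ :=
  hφ.contDiff.continuous.memLp_of_hasCompactSupport hφ.hasCompactSupport

/-- The space `C_c^∞(D)`. -/
def testFunctions {n : ℕ} (D : Set (E n)) : Submodule ℝ (E n → ℝ) where
  carrier := {φ | IsTestFunction D φ}
  zero_mem' := ⟨contDiff_const, HasCompactSupport.zero, by simp [tsupport]⟩
  add_mem' hφ hψ := ⟨hφ.contDiff.add hψ.contDiff, hφ.hasCompactSupport.add hψ.hasCompactSupport,
    (tsupport_add _ _).trans (union_subset hφ.tsupport_subset hψ.tsupport_subset)⟩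
  smul_mem' c φ hφ := ⟨contDiff_const.mul hφ.contDiff, hφ.hasCompactSupport.mul_left,
    (closure_mono (Function.support_const_smul_subset c φ)).trans hφ.tsupport_subset⟩

/-- A distributional directional derivative that is bounded in the `L²` norm is a function in
`L²`. -/
theorem exists_memLp_of_abs_integral_fderiv_le {n : ℕ} {D : Set (E n)} {F : E n → ℝ}
    (hF : MemLp F 2 (volume.restrict D)) (v : E n) {C : ℝ} (hC : 0 ≤ C)
    (h : ∀ φ, IsTestFunction D φ →
      |∫ x in D, F x * fderiv ℝ φ x v| ≤ C * Real.sqrt (∫ x in D, φ x ^ 2)) :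
    ∃ u, MemLp u 2 (volume.restrict D) ∧ eLpNorm u 2 (volume.restrict D) ≤ ENNReal.ofReal C ∧
      ∀ φ, IsTestFunction D φ → ∫ x in D, F x * fderiv ℝ φ x v = ∫ x in D, u x * φ x := by
  have hmem : ∀ φ : testFunctions D, MemLp (φ : E n → ℝ) 2 (volume.restrict D) :=
    fun φ => IsTestFunction.memLp φ.2 _
  have hdiff : ∀ φ : testFunctions D, Differentiable ℝ (φ : E n → ℝ) :=
    fun φ => (IsTestFunction.contDiff φ.2).differentiable (by simp)
  have hint : ∀ φ : testFunctions D,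
      Integrable (fun x => F x * fderiv ℝ (φ : E n → ℝ) x v) (volume.restrict D) :=
    fun φ => hF.integrable_mul ((IsTestFunction.fderiv_apply φ.2 v).memLp _)
  let ι : testFunctions D →ₗ[ℝ] Lp ℝ 2 (volume.restrict D) :=
    { toFun := fun φ => (hmem φ).toLp _
      map_add' := fun φ ψ => MemLp.toLp_add (hmem φ) (hmem ψ)
      map_smul' := fun c φ => MemLp.toLp_const_smul c (hmem φ) }
  let l : testFunctions D →ₗ[ℝ] ℝ :=
    { toFun := fun φ => ∫ x in D, F x * fderiv ℝ (φ : E n → ℝ) x v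
      map_add' := fun φ ψ => by
        rw [← integral_add (hint φ) (hint ψ)]
        congr 1
        ext x
        rw [Submodule.coe_add, fderiv_add (hdiff φ x) (hdiff ψ x), add_apply, mul_add]
      map_smul' := fun c φ => by
        rw [RingHom.id_apply, smul_eq_mul, ← integral_const_mul]
        congr 1
        ext x
        rw [Submodule.coe_smul, fderiv_const_smul (hdiff φ x), smul_apply,
          smul_eq_mul]
        ring }
  have hnorm : ∀ φ, ‖ι φ‖ = Real.sqrt (∫ x in D, (φ : E n → ℝ) x ^ 2) := fun φ => by
    change ‖(hmem φ).toLp _‖ = _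
    rw [Lp.norm_toLp, eLpNorm_two_eq (hmem φ), ENNReal.toReal_ofReal (Real.sqrt_nonneg _)]
  -- The hypothesis `h` says exactly that `l` is bounded by the `L²` norm, so `l` is the inner
  -- product with some `z` in `L²`.
  obtain ⟨z, hz, hzl⟩ := exists_inner_eq_of_bounded ι l hC fun φ => by
    rw [hnorm]
    exact h φ φ.2
  refine ⟨z, Lp.memLp z, ?_, fun φ hφ => ?_⟩
  · rw [← ENNReal.ofReal_toReal (Lp.eLpNorm_ne_top z), ← Lp.norm_def]
    exact ENNReal.ofReal_le_ofReal hz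
  · refine (hzl ⟨φ, hφ⟩).trans ?_
    rw [L2.inner_def]
    refine integral_congr_ae ?_
    filter_upwards [(hmem ⟨φ, hφ⟩).coeFn_toLp] with x hx
    change inner ℝ (z x) (((hmem ⟨φ, hφ⟩).toLp _ : E n → ℝ) x) = _
    rw [hx]
    simp [mul_comm]

/-! ### Removing the mollifier -/

/-- The interior estimate for the distributional second derivatives. -/
theorem exists_interior_estimate (n : ℕ) (lam Lam : ℝ) (hlam : 0 < lam) (hLam : 0 ≤ Lam) :
    ∃ C : ℝ, 0 ≤ C ∧ ∀ (D D' : Set (E n)) (a : E n → Matrix (Fin n) (Fin n) ℝ) (g w : E n → ℝ)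
      (G : Fin n → E n → ℝ) (r d : ℝ), IsOpen D → IsOpen D' → IsCompact (closure D') →
      closure D' ⊆ D → IsElliptic lam Lam D a → 0 < r →
      (∀ x ∈ D, ∀ y ∈ D, ‖a x - a y‖ ≤ (1 / r) * ‖x - y‖) →
      MemLp g 2 (volume.restrict D) → (∀ j, HasWeakDeriv D ![j] w (G j)) →
      (∀ j, MemLp (G j) 2 (volume.restrict D)) →
      (∀ φ : E n → ℝ, IsTestFunction D φ →
        ∫ x in D, (a x *ᵥ fun j => G j x) ⬝ᵥ grad φ x = ∫ x in D, g x * φ x) →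
      0 < d → ENNReal.ofReal d < setDist D' (frontier D) →
      ∀ i k φ, IsTestFunction D' φ → |∫ x in D', G i x * fderiv ℝ φ x (e k)| ≤
        Real.sqrt (C * (((1 / r) ^ 2 + (4 / d) ^ 2) * (∑ j, ∫ x in D, G j x ^ 2) +
          ∫ x in D, g x ^ 2)) * Real.sqrt (∫ x in D', φ x ^ 2) := by
  obtain ⟨c, -, hmol⟩ := exists_mollifier n
  obtain ⟨C, hC, hest⟩ := exists_mollified_estimate n lam Lam c hlam hLam
  refine ⟨C, hC, ?_⟩
  intro D D' a g w G r d hD hD' hcD hsD ha hr hL hg hG hG2 heq hd0 hd i k φ hφ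
  obtain ⟨η, hη, hηc, hηs, hη0, hη1, hηD', hηd⟩ :=
    exists_cutoff hD hcD (subset_closure.trans hsD) hd0 hd
  obtain ⟨ε₀, hε₀, hthick⟩ := IsCompact.exists_cthickening_subset_open hηc hD hηs
  have hφD := hφ.mono (subset_closure.trans hsD)
  have hGI : LocallyIntegrable (D.indicator (G i)) := locallyIntegrable_of_memLp_two
    ((memLp_indicator_iff_restrict hD.measurableSet).mpr (hG2 i))
  have hdφ := hφ.fderiv_apply (e k)
  have hout : ∀ x ∉ D', φ x = 0 := fun x hx =>
    image_eq_zero_of_notMem_tsupport fun h => hx (hφ.tsupport_subset h)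
  -- The mollification scale may depend on `φ` and `δ` because the energy bound does not depend on
  -- it: `R` makes the weak-convergence error at most `δ`, and `ε₀` keeps balls around `tsupport η`
  -- inside `D`.
  refine le_of_forall_pos_le_add fun δ hδ => ?_
  obtain ⟨R, hR, hconv⟩ := exists_abs_integral_conv_mul_sub_le hGI hdφ.contDiff.continuous
    hdφ.hasCompactSupport hδ
  obtain ⟨ρ, hρ, hρc, hρ0, hρ1, hρs, hρm⟩ := hmol (min ε₀ R) (lt_min hε₀ hR)
  have h1 := hconv ρ hρ.continuous hρc hρ0 hρ1
    (hρs.trans (Metric.ball_subset_ball (min_le_right _ _)))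
  have h2 := hest D a g w η ρ G r (4 / d) (min ε₀ R) hD ha hr hL hg hG hG2 heq (by positivity)
    hη hηc hη0 hη1 hηd hρ hρc hρ0 hρ1 (lt_min hε₀ hR) hρs hρm fun x hx =>
      (Metric.closedBall_subset_closedBall (min_le_left _ _)).trans
        ((Metric.closedBall_subset_cthickening hx ε₀).trans hthick)
  have hu : ContDiff ℝ ∞ (conv (D.indicator (G i)) ρ) := contDiff_conv hGI hρ hρc
  have hdu := contDiff_fderiv_apply hu (e k)
  have h3 : ∫ x, conv (D.indicator (G i)) ρ x * fderiv ℝ φ x (e k) =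
      -∫ x, fderiv ℝ (conv (D.indicator (G i)) ρ) x (e k) * φ x := by
    refine integral_mul_fderiv_eq_neg_fderiv_mul_of_integrable ?_ ?_ ?_
      (fun x _ => (hu.differentiable (by simp)) x)
      (fun x _ => (hφ.contDiff.differentiable (by simp)) x)
    · exact (hdu.continuous.mul hφ.contDiff.continuous).integrable_of_hasCompactSupport
        hφ.hasCompactSupport.mul_left
    · exact (hu.continuous.mul hdφ.contDiff.continuous).integrable_of_hasCompactSupport
        hdφ.hasCompactSupport.mul_left
    · exact (hu.continuous.mul hφ.contDiff.continuous).integrable_of_hasCompactSupport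
        hφ.hasCompactSupport.mul_left
  have h4 : ∫ x in D', G i x * fderiv ℝ φ x (e k) =
      ∫ x, D.indicator (G i) x * fderiv ℝ φ x (e k) := by
    rw [integral_indicator_mul hD.measurableSet]
    refine (setIntegral_eq_of_subset_of_forall_sdiff_eq_zero hD.measurableSet
      (subset_closure.trans hsD) fun x hx => ?_).symm
    rw [image_eq_zero_of_notMem_tsupport fun h => hx.2 (hdφ.tsupport_subset h), mul_zero]
  -- The cutoff can be inserted because it equals `1` on `D'`, outside which `φ` vanishes.
  have h5 : ∫ x, fderiv ℝ (conv (D.indicator (G i)) ρ) x (e k) * φ x =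
      ∫ x, (η x * fderiv ℝ (conv (D.indicator (G i)) ρ) x (e k)) * φ x := by
    congr 1
    ext x
    by_cases hx : x ∈ D'
    · rw [hηD' x hx, one_mul]
    · rw [hout x hx, mul_zero, mul_zero]
  have h6 : MemLp (fun x => η x * fderiv ℝ (conv (D.indicator (G i)) ρ) x (e k)) 2 volume :=
    (hη.continuous.mul hdu.continuous).memLp_of_hasCompactSupport hηc.mul_right
  have h7 := abs_integral_mul_le_sqrt h6 (hφ.memLp volume)
  have h8 : ∫ x, (η x * fderiv ℝ (conv (D.indicator (G i)) ρ) x (e k)) ^ 2 ≤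
      ∫ x, η x ^ 2 * ∑ k, ∑ i, fderiv ℝ (conv (D.indicator (G i)) ρ) x (e k) ^ 2 := by
    refine integral_mono h6.integrable_sq (Continuous.integrable_of_hasCompactSupport ?_ ?_)
      fun x => ?_
    · refine (hη.continuous.pow 2).mul (continuous_finsetSum _ fun k _ =>
        continuous_finsetSum _ fun i _ => (contDiff_fderiv_apply (contDiff_conv
          (locallyIntegrable_of_memLp_two ((memLp_indicator_iff_restrict hD.measurableSet).mpr
            (hG2 i))) hρ hρc) (e k)).continuous.pow 2)
    · exact HasCompactSupport.mul_right
        (hηc.of_isClosed_subset (isClosed_tsupport _)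
          (closure_mono fun x hx hx' => hx (by simp [hx'])))
    · simp only [mul_pow]
      refine mul_le_mul_of_nonneg_left ?_ (sq_nonneg _)
      calc _ ≤ ∑ i, fderiv ℝ (conv (D.indicator (G i)) ρ) x (e k) ^ 2 :=
            Finset.single_le_sum
              (f := fun i => fderiv ℝ (conv (D.indicator (G i)) ρ) x (e k) ^ 2)
              (fun _ _ => sq_nonneg _) (Finset.mem_univ i)
        _ ≤ _ := Finset.single_le_sum
            (f := fun k => ∑ i, fderiv ℝ (conv (D.indicator (G i)) ρ) x (e k) ^ 2)
            (fun _ _ => Finset.sum_nonneg fun _ _ => sq_nonneg _) (Finset.mem_univ k)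
  have h9 : ∫ x, φ x ^ 2 = ∫ x in D', φ x ^ 2 := by
    refine (setIntegral_eq_integral_of_forall_compl_eq_zero fun x hx => ?_).symm
    rw [hout x hx]
    norm_num
  rw [h9] at h7
  rw [h3, h5, ← h4] at h1
  have h10 := h7.trans (mul_le_mul_of_nonneg_right (Real.sqrt_le_sqrt (h8.trans h2))
    (Real.sqrt_nonneg _))
  have h11 := abs_le.mp h1
  have h12 := abs_le.mp h10
  rw [abs_le]
  constructor <;> linarith [h11.1, h11.2, h12.1, h12.2]

/-- Second weak derivatives in `L²`, with the interior bound. -/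
theorem exists_weakDeriv_two_bound (n : ℕ) (lam Lam : ℝ) (hlam : 0 < lam) (hLam : 0 ≤ Lam) :
    ∃ C : ℝ, 0 ≤ C ∧ ∀ (D D' : Set (E n)) (a : E n → Matrix (Fin n) (Fin n) ℝ) (g w : E n → ℝ)
      (G : Fin n → E n → ℝ) (r d : ℝ), IsOpen D → IsOpen D' → IsCompact (closure D') →
      closure D' ⊆ D → IsElliptic lam Lam D a → 0 < r →
      (∀ x ∈ D, ∀ y ∈ D, ‖a x - a y‖ ≤ (1 / r) * ‖x - y‖) →
      MemLp g 2 (volume.restrict D) → (∀ j, HasWeakDeriv D ![j] w (G j)) →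
      (∀ j, MemLp (G j) 2 (volume.restrict D)) →
      (∀ φ : E n → ℝ, IsTestFunction D φ →
        ∫ x in D, (a x *ᵥ fun j => G j x) ⬝ᵥ grad φ x = ∫ x in D, g x * φ x) →
      0 < d → ENNReal.ofReal d < setDist D' (frontier D) →
      ∀ m : Fin 2 → Fin n, ∃ v, HasWeakDeriv D' m w v ∧ MemLp v 2 (volume.restrict D') ∧
        eLpNorm v 2 (volume.restrict D') ≤
          ENNReal.ofReal (C * ((4 / d + 1 / r) * Real.sqrt (∑ j, ∫ x in D, G j x ^ 2) +
            Real.sqrt (∫ x in D, g x ^ 2))) := by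
  obtain ⟨C, hC, hest⟩ := exists_interior_estimate n lam Lam hlam hLam
  refine ⟨Real.sqrt C, Real.sqrt_nonneg _, ?_⟩
  intro D D' a g w G r d hD hD' hcD hsD ha hr hL hg hG hG2 heq hd0 hd m
  have hss : D' ⊆ D := subset_closure.trans hsD
  have hS0 : 0 ≤ ∑ j, ∫ x in D, G j x ^ 2 :=
    Finset.sum_nonneg fun j _ => integral_nonneg fun x => sq_nonneg _
  have hg0 : 0 ≤ ∫ x in D, g x ^ 2 := integral_nonneg fun x => sq_nonneg _
  obtain ⟨u, hu, hun, hue⟩ := exists_memLp_of_abs_integral_fderiv_le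
    ((hG2 (m 0)).mono_measure (Measure.restrict_mono hss le_rfl)) (e (m 1)) (Real.sqrt_nonneg _)
    (hest D D' a g w G r d hD hD' hcD hsD ha hr hL hg hG hG2 heq hd0 hd (m 0) (m 1))
  have hw := (hG (m 0)).mono hD hss
  -- `u` represents `∫ G_{m 0} ∂_{m 1} φ` without the sign of an integration by parts, so the weak
  -- derivative is `-u`.
  refine ⟨fun x => -u x, ⟨hw.locallyIntegrableOn, ?_, fun φ hφ => ?_⟩, hu.neg, ?_⟩
  · exact (locallyIntegrableOn_of_locallyIntegrable_restrict
      (hu.locallyIntegrable (by norm_num))).neg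
  · have h1 := hw.integral_eq _ (hφ.fderiv_apply (e (m 1)))
    simp only [classicalDeriv_one, Matrix.cons_val_zero, pow_one, neg_mul, one_mul] at h1
    simp_rw [classicalDeriv_two m hφ.contDiff]
    rw [h1, hue φ hφ]
    simp [integral_neg]
  · refine (eLpNorm_neg u _ _).trans_le (hun.trans (ENNReal.ofReal_le_ofReal ?_))
    rw [Real.sqrt_mul hC]
    gcongr
    refine Real.sqrt_le_iff.mpr ⟨by positivity, ?_⟩
    have e1 := Real.sq_sqrt hS0
    have e2 := Real.sq_sqrt hg0
    have e3 : ((1 / r) ^ 2 + (4 / d) ^ 2) * (∑ j, ∫ x in D, G j x ^ 2) + ∫ x in D, g x ^ 2 =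
        ((1 / r) ^ 2 + (4 / d) ^ 2) * Real.sqrt (∑ j, ∫ x in D, G j x ^ 2) ^ 2 +
          Real.sqrt (∫ x in D, g x ^ 2) ^ 2 := by rw [e1, e2]
    rw [e3]
    set s := Real.sqrt (∑ j, ∫ x in D, G j x ^ 2)
    set t := Real.sqrt (∫ x in D, g x ^ 2)
    have hs : 0 ≤ s := Real.sqrt_nonneg _
    have ht : 0 ≤ t := Real.sqrt_nonneg _
    have : 0 ≤ 2 * (4 / d) * (1 / r) * s ^ 2 + 2 * (4 / d + 1 / r) * s * t := by positivity
    linarith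

/-! ### Seminorms and optimization of the distance -/

theorem sobolevSeminorm_one_eq {n : ℕ} {D : Set (E n)} {w : E n → ℝ}
    (h : ∀ j : Fin n, MemLp (weakDeriv D ![j] w) 2 (volume.restrict D)) :
    sobolevSeminorm D 1 w =
      ENNReal.ofReal (Real.sqrt (∑ j, ∫ x in D, weakDeriv D ![j] w x ^ 2)) := by
  have h1 : ∀ j, eLpNorm (weakDeriv D ![j] w) 2 (volume.restrict D) ^ 2 =
      ENNReal.ofReal (∫ x in D, weakDeriv D ![j] w x ^ 2) := fun j => by
    rw [eLpNorm_two_eq (h j), ← ENNReal.ofReal_pow (Real.sqrt_nonneg _),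
      Real.sq_sqrt (integral_nonneg fun x => sq_nonneg _)]
  have h2 : (Finset.univ.filter fun m : Fin 1 → Fin n => Monotone m) = Finset.univ :=
    Finset.filter_true_of_mem fun m _ => Subsingleton.monotone m
  rw [sobolevSeminorm, h2, ← (Equiv.funUnique (Fin 1) (Fin n)).symm.sum_comp,
    Real.sqrt_eq_rpow, ← ENNReal.ofReal_rpow_of_nonneg (Finset.sum_nonneg fun j _ =>
      integral_nonneg fun x => sq_nonneg _) (by norm_num),
    ENNReal.ofReal_sum_of_nonneg fun j _ => integral_nonneg fun x => sq_nonneg _]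
  congr 1
  refine Finset.sum_congr rfl fun j _ => ?_
  have h3 : (Equiv.funUnique (Fin 1) (Fin n)).symm j = ![j] := by
    ext i
    simp [Subsingleton.elim i 0]
  rw [h3, h1]

/-- The sum over nondecreasing pairs is enlarged to all `n ^ 2` pairs, whose square root is the
factor `n`. -/
theorem sobolevSeminorm_two_le {n : ℕ} {D : Set (E n)} {w : E n → ℝ} {X : ℝ≥0∞}
    (h : ∀ m : Fin 2 → Fin n, eLpNorm (weakDeriv D m w) 2 (volume.restrict D) ≤ X) :
    sobolevSeminorm D 2 w ≤ n * X := by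
  calc sobolevSeminorm D 2 w ≤ (∑ _m : Fin 2 → Fin n, X ^ 2) ^ (1 / 2 : ℝ) := by
        refine ENNReal.rpow_le_rpow ?_ (by norm_num)
        refine (Finset.sum_le_sum fun m _ => pow_le_pow_left' (h m) 2).trans ?_
        exact Finset.sum_le_sum_of_subset (Finset.filter_subset _ _)
    _ = ((n * X) ^ 2) ^ (1 / 2 : ℝ) := by simp [mul_pow]
    _ = n * X := by
        rw [← ENNReal.rpow_natCast, ← ENNReal.rpow_mul]
        norm_num

/-- Passing from all distances below `s` to `s` itself. -/
theorem le_of_forall_dist_lt {s S T G K R : ℝ≥0∞} (hS : S ≠ ⊤) (hK : K ≠ ⊤) (hs : 0 < s)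
    (h : ∀ d : ℝ, 0 < d → ENNReal.ofReal d < s →
      T ≤ K * ((4 / ENNReal.ofReal d + R) * S + G)) :
    T ≤ 8 * K * ((1 / s + R) * S + G) := by
  -- For infinite `s`, let `d = N + 1` tend to infinity; finiteness of `S` and `K` is what makes
  -- multiplication by them continuous in `ℝ≥0∞`.
  by_cases htop : s = ⊤
  · have h1 : ∀ N : ℕ, T ≤ K * ((4 * ((N + 1 : ℕ) : ℝ≥0∞)⁻¹ + R) * S + G) := fun N => by
      have := h (N + 1 : ℕ) (by positivity) (htop ▸ ENNReal.ofReal_lt_top)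
      rwa [ENNReal.ofReal_natCast, div_eq_mul_inv] at this
    have h2 : Tendsto (fun N : ℕ => K * ((4 * ((N + 1 : ℕ) : ℝ≥0∞)⁻¹ + R) * S + G)) atTop
        (𝓝 (K * ((4 * 0 + R) * S + G))) := by
      have h3 : Tendsto (fun N : ℕ => ((N + 1 : ℕ) : ℝ≥0∞)⁻¹) atTop (𝓝 0) :=
        ENNReal.tendsto_inv_nat_nhds_zero.comp (tendsto_add_atTop_nat 1)
      exact ENNReal.Tendsto.const_mul ((ENNReal.Tendsto.mul_const
        ((ENNReal.Tendsto.const_mul h3 (Or.inr (by norm_num))).add_const R)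
        (Or.inr hS)).add_const G) (Or.inr hK)
    refine (ge_of_tendsto' h2 h1).trans ?_
    rw [mul_zero, htop, ENNReal.div_top]
    gcongr
    exact le_mul_of_one_le_left' (by norm_num)
  -- For finite `s`, the choice `d = s / 2` turns `4 / d` into `8 / s`, which is the source of the
  -- factor `8`.
  · have hpos : 0 < s.toReal := ENNReal.toReal_pos hs.ne' htop
    have h1 := h (s.toReal / 2) (by positivity) (by
      rw [ENNReal.ofReal_lt_iff_lt_toReal (by positivity) htop]
      linarith)
    have h2 : 4 / ENNReal.ofReal (s.toReal / 2) = 8 * (1 / s) := by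
      rw [ENNReal.ofReal_div_of_pos two_pos, ENNReal.ofReal_toReal htop, ENNReal.ofReal_ofNat,
        ENNReal.div_eq_inv_mul, ENNReal.inv_div (by norm_num) (by norm_num), one_div,
        div_eq_mul_inv, mul_right_comm]
      norm_num
    rw [h2] at h1
    refine h1.trans ?_
    rw [mul_comm 8 K, mul_assoc]
    gcongr
    rw [mul_add, ← mul_assoc, mul_add]
    have h8 : ∀ x : ℝ≥0∞, x ≤ 8 * x := fun x => le_mul_of_one_le_left' (by norm_num)
    gcongr
    · exact h8 R
    · exact h8 G

end InteriorH2

open InteriorH2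
theorem lemma3p2 (n : ℕ) (lam Lam : ℝ) (hlam : 0 < lam) (hLam : 0 < Lam) :
    ∃ C : ℝ≥0, ∀ (D D' : Set (E n)) (a : E n → Matrix (Fin n) (Fin n) ℝ) (g w : E n → ℝ) (r : ℝ),
      IsOpen D → IsOpen D' → IsCompact (closure D') → closure D' ⊆ D →
      IsElliptic lam Lam D a →
      0 < r → (∀ x ∈ D, ∀ y ∈ D, ‖a x - a y‖ ≤ (1 / r) * ‖x - y‖) →
      MemLp g 2 (volume.restrict D) →
      IsWeakSolution D a g w →
      MemSobolev D' 2 w ∧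
        sobolevSeminorm D' 2 w ≤
          C * ((1 / setDist D' (frontier D) + 1 / ENNReal.ofReal r) * sobolevSeminorm D 1 w +
            eLpNorm g 2 (volume.restrict D)) := by
  obtain ⟨C, hC, hest⟩ := exists_weakDeriv_two_bound n lam Lam hlam hLam.le
  -- `8` is the loss in `le_of_forall_dist_lt`, and `n` the one in `sobolevSeminorm_two_le`.
  refine ⟨8 * (n * Real.toNNReal C), ?_⟩
  intro D D' a g w r hD hD' hcD hsD ha hr hL hg hw
  have hss : D' ⊆ D := subset_closure.trans hsD
  have hpos := setDist_frontier_pos hD hcD hsD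
  have hweak : ∀ j : Fin n, HasWeakDeriv D ![j] w (weakDeriv D ![j] w) := fun j => by
    obtain ⟨v, -, hv⟩ := hw.memSobolev.2 1 le_rfl ![j]
    exact hv.weakDeriv
  have hmem : ∀ j : Fin n, MemLp (weakDeriv D ![j] w) 2 (volume.restrict D) := fun j => by
    obtain ⟨v, hv2, hv⟩ := hw.memSobolev.2 1 le_rfl ![j]
    exact hv2.ae_eq (hv.ae_eq hD hv.weakDeriv)
  have main := fun d hd0 hd => hest D D' a g w (fun j => weakDeriv D ![j] w) r d hD hD' hcD hsD ha
    hr hL hg hweak hmem hw.integral_eq hd0 hd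
  refine ⟨⟨hw.memSobolev.1.mono_measure (Measure.restrict_mono hss le_rfl), ?_⟩, ?_⟩
  · intro j hj m
    -- Orders zero and one are inherited from `D`; for order two, any single admissible `d` gives
    -- existence.
    rcases hj.lt_or_eq with hlt | rfl
    · obtain ⟨v, hv2, hv⟩ := hw.memSobolev.2 j (by omega) m
      exact ⟨v, hv2.mono_measure (Measure.restrict_mono hss le_rfl), hv.mono hD hss⟩
    · obtain ⟨d, hd0, hds⟩ : ∃ d : ℝ, 0 < d ∧
          ENNReal.ofReal d < setDist D' (frontier D) := by
        obtain ⟨q, hq0, hq⟩ := ENNReal.lt_iff_exists_nnreal_btwn.mp hpos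
        exact ⟨q, by exact_mod_cast hq0, by rwa [ENNReal.ofReal_coe_nnreal]⟩
      obtain ⟨v, hv, hv2, -⟩ := main d hd0 hds m
      exact ⟨v, hv2, hv⟩
  · have hcoe : ((8 * (n * Real.toNNReal C) : ℝ≥0) : ℝ≥0∞) = 8 * (n * ENNReal.ofReal C) := by
      push_cast
      rfl
    rw [hcoe]
    refine le_of_forall_dist_lt (by rw [sobolevSeminorm_one_eq hmem]; exact ENNReal.ofReal_ne_top)
      (ENNReal.mul_ne_top (by simp) ENNReal.ofReal_ne_top) hpos fun d hd0 hds => ?_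
    rw [mul_assoc]
    refine sobolevSeminorm_two_le fun m => ?_
    obtain ⟨v, hv, -, hvn⟩ := main d hd0 hds m
    rw [eLpNorm_congr_ae (hv.weakDeriv.ae_eq hD' hv)]
    refine hvn.trans_eq ?_
    rw [sobolevSeminorm_one_eq hmem, eLpNorm_two_eq hg, ENNReal.ofReal_mul hC,
      ENNReal.ofReal_add (by positivity) (by positivity), ENNReal.ofReal_mul (by positivity),
      ENNReal.ofReal_add (by positivity) (by positivity), ENNReal.ofReal_div_of_pos hd0,
      ENNReal.ofReal_div_of_pos hr]
    simp
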